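/- Let $\mathcal M\subseteq\mathcal B(\mathcal H)$ be a von Neumann algebra with predual $\mathcal M_*\subseteq\mathcal M^*$ (the ultraweakly continuous functionals). Let $\mathcal M^{**}$ be its universal enveloping von Neumann algebra, that is, the double dual of $\mathcal M$ with its (Arens) product, its involution and its order, let $i:\mathcal M\to\mathcal M^{**}$ be the inclusion, and let $\mathcal M^{**}$ act on $\mathcal M^*$ by $\langle y,x\omega\rangle=\langle yx,\omega\rangle$. Let $z_0$ be the central projection of $\mathcal M^{**}$ with $z_0\mathcal M^*=\mathcal M_*$. Let $CP$ be the convex set of unital completely positive maps $\tau:\mathcal M\to\mathcal M$. Let $CP_\sigma\subseteq CP$ be the set of normal ones (those preserving least upper bounds of bounded increasing nets), and let $CP_s\subseteq CP$ be the set of singular ones (those whose normal part vanishes: $\langle\omega\tau,z_0 i(x)\rangle=0$ for all $\omega\in\mathcal M_*$ and $x\in\mathcal M$). **Proposition 2.6.** For every $\tau\in CP$ there is a unique unital normal completely positive map $\tilde\tau:\mathcal M^{**}\to\mathcal M$ with $$\langle\omega\tau,x\rangle=\langle\omega,\tilde\tau(x)\rangle\qquad(x\in\mathcal M^{**},\ \omega\in\mathcal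 M_*);$$ it is the Banach space adjoint of the map $\mathcal M_*\to\mathcal M^*$, $\omega\mapsto\omega\tau$, where $\mathcal M=(\mathcal M_*)^*$. For $\tau\in CP$: 1. For each $\lambda\in(0,1)$, there are $\tau_\sigma\in CP_\sigma$ and $\tau_s\in CP_s$ with $\tau=\lambda\tau_\sigma+(1-\lambda)\tau_s$ if and only if $\tilde\tau(z_0)=\lambda 1$. 2. $\tilde\tau(z_0)$ is a scalar multiple of $1$ if and only if $\tau$ is normal, or $\tau$ is singular, or $\tau=\lambda\tau_\sigma+(1-\lambda)\tau_s$ for some $\lambda\in(0,1)$, $\tau_\sigma\in CP_\sigma$, $\tau_s\in CP_s$. Moreover, the map $\tau\mapsto\tilde\tau$ on $CP$ is affine and one-to-one. -/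

import Mathlib

open scoped ComplexOrder InnerProductSpace

noncomputable section

/-! ### The double dual of a C⋆-algebra -/

section Bidual

variable {A : Type*} [NormedRing A] [NormedAlgebra ℂ A]

/-- The double dual `A**`. For a C⋆-algebra `A` it is a von Neumann algebra (the universal
enveloping algebra of `A`) with the product, involution and order introduced below. -/
abbrev Bidual (A : Type*) [NormedRing A] [NormedAlgebra ℂ A] : Type _ :=
  StrongDual ℂ (StrongDual ℂ A)

/-- The canonical inclusion `i : A → A**`. -/
abbrev Bidual.incl (a : A) : Bidual A := NormedSpace.inclusionInDoubleDual ℂ A a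

/-- The map `A* → (A → A*)`, `ω ↦ (a ↦ ωa)`, where `ωa` is the functional `b ↦ ω (a b)`, as a
continuous linear map. -/
def Bidual.rightAct : StrongDual ℂ A →L[ℂ] A →L[ℂ] StrongDual ℂ A :=
  (ContinuousLinearMap.compL ℂ A (A →L[ℂ] A) (StrongDual ℂ A)).flip
    (ContinuousLinearMap.mul ℂ A) ∘L ContinuousLinearMap.compL ℂ A A ℂ

theorem Bidual.rightAct_apply (ω : StrongDual ℂ A) (a b : A) :
    Bidual.rightAct ω a b = ω (a * b) := rfl

/-- The action `(x, ω) ↦ xω` of `A**` on `A*`: `⟨a, xω⟩ = ⟨x, ωa⟩` for `a ∈ A`. -/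
def Bidual.act (x : Bidual A) : StrongDual ℂ A →L[ℂ] StrongDual ℂ A :=
  ContinuousLinearMap.compL ℂ A (StrongDual ℂ A) ℂ x ∘L Bidual.rightAct

theorem Bidual.act_apply (x : Bidual A) (ω : StrongDual ℂ A) (a : A) :
    x.act ω a = x (Bidual.rightAct ω a) := rfl

/-- The (Arens) product of `A**`, the product of the universal enveloping von Neumann algebra:
`⟨x y, ω⟩ = ⟨x, yω⟩`. -/
instance Bidual.instMul : Mul (Bidual A) where
  mul x y := x ∘L Bidual.act y

theorem Bidual.mul_apply (x y : Bidual A) (ω : StrongDual ℂ A) : (x * y) ω = x (y.act ω) := rfl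

/-- The unit of `A**`. -/
instance Bidual.instOne : One (Bidual A) where
  one := Bidual.incl 1

section Star

variable [StarRing A] [NormedStarGroup A] [StarModule ℂ A]

/-- The adjoint functional `ω⋆(a) = conj (ω (a⋆))`. -/
def dualStar (ω : StrongDual ℂ A) : StrongDual ℂ A :=
  LinearMap.mkContinuous
    { toFun := fun a => star (ω (star a))
      map_add' := fun a b => by simp
      map_smul' := fun c a => by simp [star_smul] }
    ‖ω‖ (fun a => by simpa using ω.le_opNorm (star a))

theorem dualStar_apply (ω : StrongDual ℂ A) (a : A) : dualStar ω a = star (ω (star a)) := rfl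

theorem norm_dualStar_le (ω : StrongDual ℂ A) : ‖dualStar ω‖ ≤ ‖ω‖ :=
  LinearMap.mkContinuous_norm_le _ (norm_nonneg _) _

/-- The involution of `A**`: `x⋆(ω) = conj (x (ω⋆))`. -/
instance Bidual.instStar : Star (Bidual A) where
  star x := LinearMap.mkContinuous
    { toFun := fun ω => star (x (dualStar ω))
      map_add' := fun ω ρ => by
        have h : dualStar (ω + ρ) = dualStar ω + dualStar ρ := by
          ext a; simp [dualStar_apply]
        simp [h]
      map_smul' := fun c ω => by
        have h : dualStar (c • ω) = star c • dualStar ω := by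
          ext a; simp [dualStar_apply]
        simp [h] }
    ‖x‖ (fun ω => by
      have h := x.le_opNorm (dualStar ω)
      have h' := mul_le_mul_of_nonneg_left (norm_dualStar_le ω) (norm_nonneg x)
      simpa using h.trans h')

theorem Bidual.star_apply (x : Bidual A) (ω : StrongDual ℂ A) :
    (star x) ω = star (x (dualStar ω)) := rfl

end Star

/-- The order of `A**`: `x ≤ y` iff `⟨x, ω⟩ ≤ ⟨y, ω⟩` for every positive `ω ∈ A*`. (The order on
`ℂ` is that of `ComplexOrder`: `0 ≤ c` means that `c` is real and nonnegative.) -/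
instance Bidual.instPreorder [PartialOrder A] : Preorder (Bidual A) where
  le x y := ∀ ω : StrongDual ℂ A, (∀ a : A, 0 ≤ a → 0 ≤ ω a) → x ω ≤ y ω
  le_refl _ _ _ := le_rfl
  le_trans _ _ _ hxy hyz ω hω := (hxy ω hω).trans (hyz ω hω)

end Bidual

/-! ### Completely positive maps on a von Neumann algebra -/

namespace VonNeumannAlgebra

variable {H : Type*} [NormedAddCommGroup H] [InnerProductSpace ℂ H] [CompleteSpace H]
  (M : VonNeumannAlgebra H)

/-- The von Neumann algebra `M ⊆ B(H)` as a type; it carries the algebraic structure, the norm and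
the order of operators inherited from `B(H)`. -/
abbrev Elem : Type _ := M.toStarSubalgebra

/-- The predual `M_*`, as a set of functionals in `M*`: the ultraweakly continuous functionals
`x ↦ ∑ ⟨ξ_k, x η_k⟩` with `∑ ‖ξ_k‖² < ∞` and `∑ ‖η_k‖² < ∞`. -/
def predual : Set (StrongDual ℂ M.Elem) :=
  {ω | ∃ ξ η : ℕ → H, Summable (fun k => ‖ξ k‖ ^ 2) ∧ Summable (fun k => ‖η k‖ ^ 2) ∧
    ∀ x : M.Elem, HasSum (fun k => ⟪ξ k, (x : H →L[ℂ] H) (η k)⟫_ℂ) (ω x)}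

variable {M}

/-- Positivity of a matrix with entries in `M`, as an operator on `H ⊕ ⋯ ⊕ H`. -/
def IsPosMatrix {n : ℕ} (a : Matrix (Fin n) (Fin n) M.Elem) : Prop :=
  ∀ ξ : Fin n → H, 0 ≤ ∑ i, ∑ j, ⟪ξ i, (a i j : H →L[ℂ] H) (ξ j)⟫_ℂ

/-- Positivity of a matrix with entries in `M**`, under the identification of `M_n(M**)` with
`M_n(M)**`: the matrix is nonnegative on every positive functional
`a ↦ ∑ Φ_ij(a_ij)` of `M_n(M)`. -/
def IsPosBidualMatrix {n : ℕ} (x : Matrix (Fin n) (Fin n) (Bidual M.Elem)) : Prop :=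
  ∀ Φ : Matrix (Fin n) (Fin n) (StrongDual ℂ M.Elem),
    (∀ a : Matrix (Fin n) (Fin n) M.Elem, IsPosMatrix a → 0 ≤ ∑ i, ∑ j, Φ i j (a i j)) →
      0 ≤ ∑ i, ∑ j, x i j (Φ i j)

/-- Complete positivity of a map `M → M`. -/
def IsCP (τ : M.Elem →L[ℂ] M.Elem) : Prop :=
  ∀ (n : ℕ) (a : Matrix (Fin n) (Fin n) M.Elem), IsPosMatrix a → IsPosMatrix (a.map τ)

/-- Complete positivity of a map `M** → M`. -/
def IsBidualCP (T : Bidual M.Elem →L[ℂ] M.Elem) : Prop :=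
  ∀ (n : ℕ) (x : Matrix (Fin n) (Fin n) (Bidual M.Elem)),
    IsPosBidualMatrix x → IsPosMatrix (x.map T)

variable (M) in
/-- `CP`: the unital completely positive maps on `M`. (Positive maps on `M` are automatically
bounded.) -/
def CP : Set (M.Elem →L[ℂ] M.Elem) := {τ | IsCP τ ∧ τ 1 = 1}

variable (M) in
/-- `CP_σ`: the unital completely positive maps that are normal, that is, preserve least upper
bounds of bounded increasing nets. -/
def CPσ : Set (M.Elem →L[ℂ] M.Elem) := {τ | τ ∈ CP M ∧ ScottContinuous τ}

/-- `CP_s`: the unital completely positive maps that are singular. With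
`ω_σ(x) = ⟨ω, z₀ i(x)⟩` the normal part of `ω ∈ M*`, the normal part `τ_σ` of `τ` is the map with
`ω τ_σ = (ω τ)_σ` for `ω ∈ M_*`, and `τ` is singular if `τ_σ = 0`. -/
def CPs (z₀ : Bidual M.Elem) : Set (M.Elem →L[ℂ] M.Elem) :=
  {τ | τ ∈ CP M ∧ ∀ ω ∈ M.predual, ∀ x : M.Elem, (z₀ * Bidual.incl x) (ω ∘L τ) = 0}

/-- `z₀` is the central projection of `M**` with `z₀ M* = M_*`. -/
structure IsNormalProjection (z₀ : Bidual M.Elem) : Prop where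
  isStarProjection : IsStarProjection z₀
  central : ∀ x : Bidual M.Elem, z₀ * x = x * z₀
  range_act : Set.range (fun ω : StrongDual ℂ M.Elem => z₀.act ω) = M.predual

/-! ### The normal extension -/

/-- The vector functional `x ↦ ⟨ξ, x η⟩` on `M`. -/
def vectorFunctional (ξ η : H) : StrongDual ℂ M.Elem :=
  LinearMap.mkContinuous
    { toFun := fun x => ⟪ξ, (x : H →L[ℂ] H) η⟫_ℂ
      map_add' := fun x y => by simp
      map_smul' := fun c x => by simp }
    (‖ξ‖ * ‖η‖) (fun x => by
      have h1 := norm_inner_le_norm (𝕜 := ℂ) ξ ((x : H →L[ℂ] H) η)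
      have h2 := (x : H →L[ℂ] H).le_opNorm η
      have h3 : ‖x‖ = ‖(x : H →L[ℂ] H)‖ := rfl
      have h4 := mul_le_mul_of_nonneg_left h2 (norm_nonneg ξ)
      simp only [LinearMap.coe_mk, AddHom.coe_mk]
      rw [h3]
      linarith)

theorem vectorFunctional_apply (ξ η : H) (x : M.Elem) :
    vectorFunctional ξ η x = ⟪ξ, (x : H →L[ℂ] H) η⟫_ℂ := rfl

theorem norm_vectorFunctional_le (ξ η : H) :
    ‖(vectorFunctional ξ η : StrongDual ℂ M.Elem)‖ ≤ ‖ξ‖ * ‖η‖ :=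
  LinearMap.mkContinuous_norm_le _ (by positivity) _

/-- The sesquilinear form `(ξ, η) ↦ ⟨ω_{ξ,η} τ, x⟩`, where `ω_{ξ,η}` is a vector functional. -/
def extForm (τ : M.Elem →L[ℂ] M.Elem) (x : Bidual M.Elem) : H →L⋆[ℂ] H →L[ℂ] ℂ :=
  LinearMap.mkContinuous₂
    (LinearMap.mk₂'ₛₗ (starRingEnd ℂ) (RingHom.id ℂ)
      (fun ξ η : H => x (vectorFunctional ξ η ∘L τ))
      (fun ξ ξ' η => by
        rw [← map_add]; congr 1; ext a; simp [vectorFunctional_apply])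
      (fun c ξ η => by
        rw [← map_smul]; congr 1; ext a; simp [vectorFunctional_apply, mul_comm])
      (fun ξ η η' => by
        rw [← map_add]; congr 1; ext a; simp [vectorFunctional_apply])
      (fun c ξ η => by
        rw [← map_smul]; congr 1; ext a; simp [vectorFunctional_apply]))
    (‖x‖ * ‖τ‖) (fun ξ η => by
      have h1 := x.le_opNorm (vectorFunctional ξ η ∘L τ)
      have h2 := (vectorFunctional ξ η : StrongDual ℂ M.Elem).opNorm_comp_le τ
      have h3 := mul_le_mul_of_nonneg_right
        (norm_vectorFunctional_le (M := M) ξ η) (norm_nonneg τ)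
      have h4 := mul_le_mul_of_nonneg_left (h2.trans h3) (norm_nonneg x)
      simp only [LinearMap.mk₂'ₛₗ_apply]
      calc _ ≤ _ := h1
        _ ≤ _ := h4
        _ = _ := by ring)

theorem extForm_apply (τ : M.Elem →L[ℂ] M.Elem) (x : Bidual M.Elem) (ξ η : H) :
    extForm τ x ξ η = x (vectorFunctional ξ η ∘L τ) := rfl

/-- The operator on `H` with `⟨ξ, T η⟩ = ⟨ω_{ξ,η} τ, x⟩`. -/
def extOp (τ : M.Elem →L[ℂ] M.Elem) (x : Bidual M.Elem) : H →L[ℂ] H :=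
  ContinuousLinearMap.adjoint (InnerProductSpace.continuousLinearMapOfBilin (extForm τ x))

theorem inner_extOp (τ : M.Elem →L[ℂ] M.Elem) (x : Bidual M.Elem) (ξ η : H) :
    ⟪ξ, extOp τ x η⟫_ℂ = x (vectorFunctional ξ η ∘L τ) := by
  rw [extOp, ContinuousLinearMap.adjoint_inner_right,
    InnerProductSpace.continuousLinearMapOfBilin_apply, extForm_apply]

theorem extOp_mem (τ : M.Elem →L[ℂ] M.Elem) (x : Bidual M.Elem) :
    extOp τ x ∈ M.toStarSubalgebra := by
  change extOp τ x ∈ (M : Set (H →L[ℂ] H))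
  rw [← M.centralizer_centralizer]
  intro b hb
  ext η
  refine ext_inner_left ℂ fun ξ => ?_
  change ⟪ξ, b (extOp τ x η)⟫_ℂ = ⟪ξ, extOp τ x (b η)⟫_ℂ
  rw [← ContinuousLinearMap.adjoint_inner_left, inner_extOp, inner_extOp]
  congr 1
  ext a
  have h : (τ a : H →L[ℂ] H) * b = b * (τ a : H →L[ℂ] H) := hb _ (τ a).2
  have h' : (τ a : H →L[ℂ] H) (b η) = b ((τ a : H →L[ℂ] H) η) := congrArg (fun f => f η) h
  simp [vectorFunctional_apply, ContinuousLinearMap.adjoint_inner_left, h']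

theorem norm_extOp_le (τ : M.Elem →L[ℂ] M.Elem) (x : Bidual M.Elem) :
    ‖extOp τ x‖ ≤ ‖τ‖ * ‖x‖ := by
  refine ContinuousLinearMap.opNorm_le_bound _ (by positivity) fun η => ?_
  have h : ‖⟪extOp τ x η, extOp τ x η⟫_ℂ‖ ≤ ‖τ‖ * ‖x‖ * ‖extOp τ x η‖ * ‖η‖ := by
    rw [inner_extOp, ← extForm_apply]
    refine ((extForm τ x).le_opNorm₂ _ _).trans ?_
    have : ‖extForm τ x‖ ≤ ‖x‖ * ‖τ‖ := LinearMap.mkContinuous₂_norm_le _ (by positivity) _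
    rw [mul_comm ‖τ‖]
    gcongr
  rw [inner_self_eq_norm_sq_to_K] at h
  simp only [norm_pow, Complex.coe_algebraMap, Complex.norm_real, norm_norm] at h
  rcases (norm_nonneg (extOp τ x η)).eq_or_lt with h0 | h0
  · rw [← h0]; positivity
  · refine le_of_mul_le_mul_left ?_ h0
    nlinarith

/-- The extension `τ̃ : M** → M` of `τ : M → M`: the Banach space adjoint of the map
`M_* → M*`, `ω ↦ ω τ`, under the identification of `M` with the dual of `M_*`. -/
def normalExt (τ : M.Elem →L[ℂ] M.Elem) : Bidual M.Elem →L[ℂ] M.Elem :=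
  LinearMap.mkContinuous
    { toFun := fun x => ⟨extOp τ x, extOp_mem τ x⟩
      map_add' := fun x y => by
        refine Subtype.ext ?_
        ext η
        refine ext_inner_left ℂ fun ξ => ?_
        simp [inner_add_right, inner_extOp]
      map_smul' := fun c x => by
        refine Subtype.ext ?_
        ext η
        refine ext_inner_left ℂ fun ξ => ?_
        simp [inner_smul_right, inner_extOp] }
    ‖τ‖ (fun x => norm_extOp_le τ x)

/-- `T : M** → M` is a completely positive unital normal map such that
`⟨ω τ, x⟩ = ⟨ω, T x⟩` for all `x ∈ M**` and `ω ∈ M_*`. -/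
structure IsNormalExt (τ : M.Elem →L[ℂ] M.Elem) (T : Bidual M.Elem →L[ℂ] M.Elem) : Prop where
  cp : IsBidualCP T
  map_one : T 1 = 1
  normal : ScottContinuous T
  duality : ∀ ω ∈ M.predual, ∀ x : Bidual M.Elem, x (ω ∘L τ) = ω (T x)

end VonNeumannAlgebra

end

/-!
Since `τ̃(1) = 1`, the weights `τ̃(z₀) = λ` and `τ̃(1 - z₀) = 1 - λ` occur together. The maps
`a ↦ τ̃(i(a) z₀)` and `a ↦ τ̃(i(a) (1 - z₀))` are completely positive with sum `τ`; divided by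
their weights they are `τ_σ` and `τ_s`. So the proposition reduces to reading normality and
singularity off `τ̃(z₀)`: `τ` is singular iff `τ̃(z₀) = 0` and normal iff `τ̃(z₀) = 1`.

The hard point is that a normal `τ` has `τ̃(1 - z₀) = 0`, that is, that a Scott continuous positive
functional `ψ` with `z₀ ψ = 0` vanishes. For a vector functional `ω` one has `z₀ ω = ω`, so `z₀` is
a vector of the Hilbert space of the form `ψ(y x⋆) + ω(x⋆ y)` on `M`; elements `b` of `M` close to
it make `ψ(b b⋆)` and `ω((1 - b)⋆ (1 - b))` small. Damping multiples of the `b b⋆` by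
`a ↦ 1 - (1 + a)⁻¹`, a Borel–Cantelli argument produces `0 ≤ c ≤ 1` in `M` with `ψ(c) = 0` and
`ω(1 - c) = 0`. As `ω` varies, the supremum of the damped positive elements on which `ψ` vanishes
is therefore `1`; the family being directed, `ψ(1) = 0`.
-/

noncomputable section

namespace EnvelopingAlgebra

open VonNeumannAlgebra Filter Topology ComplexStarModule

section PositiveMaps

/-- Positivity of a bounded linear map between ordered Banach spaces: it preserves the cones of
nonnegative elements. It is used both for functionals on `A` and for maps `M → M`. -/
def IsPositiveMap {E F : Type*} [NormedAddCommGroup E] [NormedSpace ℂ E] [PartialOrder E]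
    [NormedAddCommGroup F] [NormedSpace ℂ F] [PartialOrder F] (φ : E →L[ℂ] F) : Prop :=
  ∀ a, 0 ≤ a → 0 ≤ φ a

variable {E F : Type*} [NormedAddCommGroup E] [NormedSpace ℂ E] [PartialOrder E]
  [IsOrderedAddMonoid E] [NormedAddCommGroup F] [NormedSpace ℂ F] [PartialOrder F]
  [IsOrderedAddMonoid F]

theorem IsPositiveMap.monotone {φ : E →L[ℂ] F} (hφ : IsPositiveMap φ) : Monotone φ :=
  fun a b hab => sub_nonneg.1 <| by simpa only [map_sub] using hφ _ (sub_nonneg.2 hab)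

theorem IsPositiveMap.map_star {A : Type*} [CStarAlgebra A] [PartialOrder A] [StarOrderedRing A]
    {φ : StrongDual ℂ A} (hφ : IsPositiveMap φ) (a : A) : φ (star a) = star (φ a) :=
  StarHomClass.map_star (PositiveLinearMap.mk₀ (φ : A →ₗ[ℂ] ℂ) hφ) a

end PositiveMaps

section OperatorOrder

variable {H : Type*} [NormedAddCommGroup H] [InnerProductSpace ℂ H] [CompleteSpace H]
  {M : VonNeumannAlgebra H}

theorem nonneg_iff {a : M.Elem} : 0 ≤ a ↔ ∀ ξ, 0 ≤ ⟪ξ, (a : H →L[ℂ] H) ξ⟫_ℂ := by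
  change 0 ≤ (a : H →L[ℂ] H) ↔ _
  rw [ContinuousLinearMap.nonneg_iff_isPositive, ContinuousLinearMap.isPositive_iff_complex]
  refine forall_congr' fun ξ => ?_
  rw [← inner_conj_symm ξ, ← Complex.star_def, star_nonneg_iff, Complex.nonneg_iff,
    Complex.ext_iff]
  simp [and_comm]

theorem le_iff {a b : M.Elem} :
    a ≤ b ↔ ∀ ξ, ⟪ξ, (a : H →L[ℂ] H) ξ⟫_ℂ ≤ ⟪ξ, (b : H →L[ℂ] H) ξ⟫_ℂ := by
  have h : a ≤ b ↔ 0 ≤ b - a := (sub_nonneg (α := H →L[ℂ] H)).symm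
  rw [h, nonneg_iff]
  simp [sub_nonneg]

theorem eq_of_forall_inner {a b : M.Elem}
    (h : ∀ ξ η, ⟪ξ, (a : H →L[ℂ] H) η⟫_ℂ = ⟪ξ, (b : H →L[ℂ] H) η⟫_ℂ) : a = b :=
  Subtype.ext <| ContinuousLinearMap.ext fun η => ext_inner_left ℂ fun ξ => h ξ η

theorem mem_of_forall_commute {a : M.Elem} {b : H →L[ℂ] H}
    (h : ∀ c, Commute (a : H →L[ℂ] H) c → Commute b c) : b ∈ M.toStarSubalgebra := by
  change b ∈ (M : Set (H →L[ℂ] H))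
  rw [← M.centralizer_centralizer, Set.mem_centralizer_iff]
  exact fun c hc => (h c (Set.mem_centralizer_iff.1 hc _ a.2)).symm

scoped instance isClosed_coe : IsClosed (M.toStarSubalgebra : Set (H →L[ℂ] H)) := by
  change IsClosed (M : Set (H →L[ℂ] H))
  rw [← M.centralizer_centralizer]
  exact Set.isClosed_centralizer _

scoped instance : IsOrderedAddMonoid M.Elem where
  add_le_add_left _ _ h c := add_le_add_left (α := H →L[ℂ] H) h c

scoped instance : StarOrderedRing M.Elem :=
  .of_nonneg_iff' (fun h c => add_le_add_right (α := H →L[ℂ] H) h c) fun a => by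
    refine ⟨fun ha => ?_, ?_⟩
    · have hsq := CFC.sqrt_mul_sqrt_self (a : H →L[ℂ] H) ha
      refine ⟨⟨CFC.sqrt (a : H →L[ℂ] H), mem_of_forall_commute fun c hc => hc.cfcₙ_nnreal _⟩,
        Subtype.ext ?_⟩
      simpa [(CFC.sqrt_nonneg (a : H →L[ℂ] H)).isSelfAdjoint.star_eq] using hsq.symm
    · rintro ⟨b, rfl⟩
      exact star_mul_self_nonneg (b : H →L[ℂ] H)

theorem vectorFunctional_self_isPositiveMap (ξ : H) :
    IsPositiveMap (vectorFunctional ξ ξ : StrongDual ℂ M.Elem) :=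
  fun _ ha => nonneg_iff.1 ha ξ

end OperatorOrder

section JordanDecomposition

/-- An abstract Jordan decomposition, by extending `(a, -a) ↦ F a` to `V × V`. -/
theorem exists_eq_sub_of_orderUnit {V : Type*} [AddCommGroup V] [PartialOrder V]
    [IsOrderedAddMonoid V] [Module ℝ V] [IsOrderedModule ℝ V] {e : V} (he : 0 ≤ e)
    (hunit : ∀ b : V, ∃ t : ℝ, -b ≤ t • e) (F : V →ₗ[ℝ] ℝ) {C : ℝ}
    (hF : ∀ a (t : ℝ), a ≤ t • e → -a ≤ t • e → F a ≤ C * t) :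
    ∃ g₁ g₂ : V →ₗ[ℝ] ℝ, (∀ b, 0 ≤ b → 0 ≤ g₁ b) ∧ (∀ b, 0 ≤ b → 0 ≤ g₂ b) ∧ F = g₁ - g₂ := by
  let L : (V × V) × ℝ →ₗ[ℝ] V × V := LinearMap.fst ℝ _ ℝ + (LinearMap.snd ℝ _ ℝ).smulRight (e, e)
  let Q : PointedCone ℝ ((V × V) × ℝ) := (PointedCone.positive ℝ (V × V)).comap L
  have mem_Q : ∀ b c t, (((b, c), t) : (V × V) × ℝ) ∈ Q ↔ -b ≤ t • e ∧ -c ≤ t • e := fun b c t => by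
    change 0 ≤ b + t • e ∧ 0 ≤ c + t • e ↔ _
    rw [neg_le_iff_add_nonneg', neg_le_iff_add_nonneg']
  let antidiagonal : Submodule ℝ ((V × V) × ℝ) :=
    LinearMap.ker ((LinearMap.fst ℝ V V + LinearMap.snd ℝ V V) ∘ₗ LinearMap.fst ℝ _ ℝ)
  let F' : (V × V) × ℝ →ₗ[ℝ] ℝ := (F ∘ₗ LinearMap.fst ℝ V V).coprod (C • LinearMap.id)
  obtain ⟨g, hgF, hg⟩ := riesz_extension Q (F'.toPMap antidiagonal)
    (by
      rintro ⟨⟨⟨a, a'⟩, t⟩, hd⟩ hx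
      obtain rfl : a' = -a := (neg_eq_of_add_eq_zero_right hd).symm
      obtain ⟨h₁, h₂⟩ := (mem_Q _ _ _).1 hx
      have := hF (-a) t h₁ h₂
      rw [map_neg] at this
      change 0 ≤ F a + C * t
      linarith)
    (by
      rintro ⟨⟨b, c⟩, t⟩
      obtain ⟨u, hu⟩ := hunit b
      obtain ⟨v, hv⟩ := hunit c
      refine ⟨⟨((0, 0), max u v - t), add_zero _⟩, ?_⟩
      have key : (((0, 0), max u v - t) + ((b, c), t) : (V × V) × ℝ) = ((b, c), max u v) := by simp
      change (((0, 0), max u v - t) + ((b, c), t) : (V × V) × ℝ) ∈ Q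
      rw [key, mem_Q]
      exact ⟨hu.trans (smul_le_smul_of_nonneg_right (le_max_left u v) he),
        hv.trans (smul_le_smul_of_nonneg_right (le_max_right u v) he)⟩)
  refine ⟨g ∘ₗ LinearMap.inl ℝ _ ℝ ∘ₗ LinearMap.inl ℝ V V,
    g ∘ₗ LinearMap.inl ℝ _ ℝ ∘ₗ LinearMap.inr ℝ V V,
    fun b hb => hg _ ((mem_Q _ _ _).2 (by simpa using hb)),
    fun b hb => hg _ ((mem_Q _ _ _).2 (by simpa using hb)), LinearMap.ext fun a => ?_⟩
  have hsub : (((a, -a), 0) : (V × V) × ℝ) = ((a, 0), 0) - ((0, a), 0) := by simp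
  calc F a = F' ((a, -a), 0) := by simp [F']
    _ = g ((a, -a), 0) := (hgF ⟨((a, -a), 0), add_neg_cancel a⟩).symm
    _ = g ((a, 0), 0) - g ((0, a), 0) := by rw [hsub, map_sub]

variable {A : Type*} [CStarAlgebra A] [PartialOrder A] [StarOrderedRing A]

theorem norm_le_of_le_smul_one [Nontrivial A] {a : A} {t : ℝ} (h₁ : a ≤ t • 1)
    (h₂ : -a ≤ t • 1) : ‖a‖ ≤ 3 * t := by
  have hpos : 0 ≤ a + t • 1 := by rwa [← neg_le_iff_add_nonneg']
  have hle : a + t • 1 ≤ algebraMap ℝ A (2 * t) := by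
    rw [Algebra.algebraMap_eq_smul_one, two_mul, add_smul]
    exact add_le_add_left h₁ _
  have ht : 0 ≤ t := by
    have := hpos.trans hle
    rw [← map_zero (algebraMap ℝ A)] at this
    have := (algebraMap_le_algebraMap (β := A)).1 this
    linarith
  calc ‖a‖ = ‖(a + t • 1) - t • 1‖ := by rw [add_sub_cancel_right]
    _ ≤ ‖a + t • 1‖ + ‖t • (1 : A)‖ := norm_sub_le _ _
    _ ≤ 2 * t + t := by
      gcongr
      · exact (CStarAlgebra.norm_le_iff_le_algebraMap _ (by positivity) hpos).2 hle
      · simp [norm_smul, abs_of_nonneg ht]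
    _ = 3 * t := by ring

theorem exists_isPositiveMap_of_nonneg (g : selfAdjoint A →ₗ[ℝ] ℝ) (hg : ∀ b, 0 ≤ b → 0 ≤ g b) :
    ∃ ω : StrongDual ℂ A, IsPositiveMap ω ∧ ∀ a : selfAdjoint A, ω a = g a := by
  let ω : A →ₗ[ℂ] ℂ := Module.Dual.extendRCLike (g ∘ₗ realPart)
  have hω : ∀ a : selfAdjoint A, ω a = g a := fun a => by
    simp [ω, Module.Dual.extendRCLike_apply, realPart_I_smul, a.2.imaginaryPart]
  have hpos : ∀ a, 0 ≤ a → 0 ≤ ω a := fun a ha => by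
    rw [hω ⟨a, ha.isSelfAdjoint⟩]
    exact Complex.zero_le_real.2 (hg _ ha)
  exact ⟨⟨ω, map_continuous (PositiveLinearMap.mk₀ ω hpos)⟩, hpos, hω⟩

theorem exists_isPositiveMap_sub_eq_re [Nontrivial A] (f : StrongDual ℂ A) :
    ∃ ω₁ ω₂ : StrongDual ℂ A, IsPositiveMap ω₁ ∧ IsPositiveMap ω₂ ∧
      ∀ a : selfAdjoint A, ((f a).re : ℂ) = ω₁ a - ω₂ a := by
  have : IsOrderedModule ℝ (selfAdjoint A) :=
    { smul_le_smul_of_nonneg_left := fun _ hr _ _ h => smul_le_smul_of_nonneg_left (β := A) h hr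
      smul_le_smul_of_nonneg_right := fun _ ha _ _ h => smul_le_smul_of_nonneg_right (β := A) h ha }
  let F : selfAdjoint A →ₗ[ℝ] ℝ := Complex.reLm ∘ₗ (f : A →ₗ[ℂ] ℂ).restrictScalars ℝ ∘ₗ
    (selfAdjoint.submodule ℝ A).subtype
  obtain ⟨g₁, g₂, hg₁, hg₂, hF⟩ := exists_eq_sub_of_orderUnit (V := selfAdjoint A) (e := 1)
    (zero_le_one (α := A))
    (fun b => ⟨‖b‖, by
      have := b.2.neg_algebraMap_norm_le_self
      rw [Algebra.algebraMap_eq_smul_one] at this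
      exact neg_le.1 this⟩) F (C := ‖f‖ * 3)
    (fun a t h₁ h₂ => calc
      F a ≤ ‖f a‖ := Complex.re_le_norm _
      _ ≤ ‖f‖ * ‖(a : A)‖ := f.le_opNorm _
      _ ≤ ‖f‖ * 3 * t := by
        rw [mul_assoc]
        gcongr
        exact norm_le_of_le_smul_one h₁ h₂)
  obtain ⟨ω₁, hω₁, h₁⟩ := exists_isPositiveMap_of_nonneg g₁ hg₁
  obtain ⟨ω₂, hω₂, h₂⟩ := exists_isPositiveMap_of_nonneg g₂ hg₂
  refine ⟨ω₁, ω₂, hω₁, hω₂, fun a => ?_⟩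
  rw [h₁, h₂, ← Complex.ofReal_sub, ← LinearMap.sub_apply, ← hF]
  rfl

theorem span_isPositiveMap : Submodule.span ℂ {ω : StrongDual ℂ A | IsPositiveMap ω} = ⊤ := by
  rcases subsingleton_or_nontrivial A with hA | hA
  · exact Subsingleton.elim _ _
  refine eq_top_iff.2 fun f _ => ?_
  obtain ⟨ω₁, ω₂, hω₁, hω₂, hre⟩ := exists_isPositiveMap_sub_eq_re f
  obtain ⟨ω₃, ω₄, hω₃, hω₄, him⟩ := exists_isPositiveMap_sub_eq_re (-Complex.I • f)
  have key : ∀ a : selfAdjoint A, f a = ((ω₁ - ω₂) + Complex.I • (ω₃ - ω₄)) a := fun a => by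
    have him' := him a
    simp only [smul_apply, smul_eq_mul, neg_mul, Complex.neg_re, Complex.I_mul_re,
      neg_neg] at him'
    rw [← Complex.re_add_im (f a), hre, him']
    simp [mul_comm]
  have hf : f = (ω₁ - ω₂) + Complex.I • (ω₃ - ω₄) := by
    ext a
    rw [← realPart_add_I_smul_imaginaryPart a, map_add, map_add, map_smul, map_smul, key, key]
  rw [hf]
  exact add_mem (sub_mem (Submodule.subset_span hω₁) (Submodule.subset_span hω₂))
    (Submodule.smul_mem _ _ (sub_mem (Submodule.subset_span hω₃) (Submodule.subset_span hω₄)))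

end JordanDecomposition

section MonotoneConvergence

theorem exists_tendsto_complex_of_monotone {ι : Type*} [Preorder ι] {u : ι → ℂ} (hu : Monotone u)
    {c : ℂ} (hc : ∀ i, u i ≤ c) : ∃ l, Tendsto u atTop (𝓝 l) := by
  have hre : Tendsto (fun i => (u i).re) atTop (𝓝 (⨆ i, (u i).re)) :=
    tendsto_atTop_ciSup (fun _ _ h => (Complex.le_def.1 (hu h)).1)
      ⟨c.re, Set.forall_mem_range.2 fun i => (Complex.le_def.1 (hc i)).1⟩
  have him : ∀ i, (u i).im = c.im := fun i => (Complex.le_def.1 (hc i)).2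
  refine ⟨(⨆ i, (u i).re : ℝ) + c.im * Complex.I, ?_⟩
  simpa only [him, Complex.re_add_im] using
    (((Complex.continuous_ofReal.tendsto _).comp hre).add_const (c.im * Complex.I)).congr
      fun i => by rw [Function.comp_apply, ← him i, Complex.re_add_im]

theorem tendsto_complex_of_isLUB {ι : Type*} [Preorder ι] [IsDirectedOrder ι] [Nonempty ι]
    {u : ι → ℂ} (hu : Monotone u) {l : ℂ} (hl : IsLUB (Set.range u) l) :
    Tendsto u atTop (𝓝 l) := by
  obtain ⟨l', hl'⟩ := exists_tendsto_complex_of_monotone hu fun i => hl.1 ⟨i, rfl⟩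
  rwa [hl.unique (isLUB_of_tendsto_atTop hu hl')]

theorem scottContinuous_complex_iff {α : Type*} [Preorder α] {f : α → ℂ} :
    ScottContinuous f ↔ Monotone f ∧ ∀ D : Set α, D.Nonempty → DirectedOn (· ≤ ·) D →
      ∀ x, IsLUB D x → Tendsto (fun d : D => f d) atTop (𝓝 (f x)) := by
  refine ⟨fun hf => ⟨hf.monotone, fun D hne hD x hx => ?_⟩, fun ⟨hf, h⟩ D hne hD x hx => ?_⟩
  all_goals
    have : Nonempty D := hne.to_subtype
    have : IsDirectedOrder D := directedOn_iff_isDirectedOrder.1 hD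
  · refine tendsto_complex_of_isLUB (u := fun d : D => f d) (fun _ _ h => hf.monotone h) ?_
    rw [← Set.image_eq_range]
    exact hf hne hD hx
  · rw [Set.image_eq_range]
    exact isLUB_of_tendsto_atTop (fun _ _ hd => hf hd) (h D hne hD x hx)

theorem scottContinuous_complex_sub {α : Type*} [Preorder α] {f g : α → ℂ}
    (hf : ScottContinuous f) (hg : ScottContinuous g) (hfg : Monotone (f - g)) :
    ScottContinuous (f - g) :=
  scottContinuous_complex_iff.2 ⟨hfg, fun D hne hD x hx =>
    ((scottContinuous_complex_iff.1 hf).2 D hne hD x hx).sub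
      ((scottContinuous_complex_iff.1 hg).2 D hne hD x hx)⟩

section Bidual

variable {A : Type*} [CStarAlgebra A] [PartialOrder A] [StarOrderedRing A]
  {ι : Type*} [Preorder ι]

theorem induction_of_isPositiveMap {p : StrongDual ℂ A → Prop} (pos : ∀ ω, IsPositiveMap ω → p ω)
    (add : ∀ ω ρ, p ω → p ρ → p (ω + ρ)) (smul : ∀ (c : ℂ) ω, p ω → p (c • ω))
    (ω : StrongDual ℂ A) : p ω := by
  have hω : ω ∈ Submodule.span ℂ {ω : StrongDual ℂ A | IsPositiveMap ω} := by
    rw [span_isPositiveMap]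
    trivial
  induction hω using Submodule.span_induction with
  | mem ω hω => exact pos ω hω
  | zero => exact pos 0 fun _ _ => le_rfl
  | add ω ρ _ _ hω hρ => exact add ω ρ hω hρ
  | smul c ω _ hω => exact smul c ω hω

theorem exists_tendsto_bidual_apply_of_monotone {x : ι → Bidual A} (hx : Monotone x)
    {y : Bidual A} (hy : ∀ i, x i ≤ y) (ω : StrongDual ℂ A) :
    ∃ l, Tendsto (fun i => x i ω) atTop (𝓝 l) := by
  induction ω using induction_of_isPositiveMap with
  | pos ω hω =>
    exact exists_tendsto_complex_of_monotone (fun _ _ h => hx h ω hω) fun i => hy i ω hω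
  | add ω ρ hω hρ =>
    obtain ⟨⟨l, hl⟩, k, hk⟩ := And.intro hω hρ
    exact ⟨l + k, by simpa only [map_add] using hl.add hk⟩
  | smul c ω hω =>
    obtain ⟨l, hl⟩ := hω
    exact ⟨c • l, by simpa only [map_smul] using hl.const_smul c⟩

theorem exists_norm_bidual_apply_le_of_monotone {x : ι → Bidual A} (hx : Monotone x)
    {y : Bidual A} (hy : ∀ i, x i ≤ y) (i₀ : ι) (ω : StrongDual ℂ A) :
    ∃ C, ∀ i : Set.Ici i₀, ‖x i ω‖ ≤ C := by
  induction ω using induction_of_isPositiveMap with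
  | pos ω hω =>
    refine ⟨‖y ω - x i₀ ω‖ + ‖x i₀ ω‖, fun i => ?_⟩
    have hnorm : ‖x i ω - x i₀ ω‖ ≤ ‖y ω - x i₀ ω‖ :=
      CStarAlgebra.norm_le_norm_of_nonneg_of_le (sub_nonneg.2 (hx i.2 ω hω))
        (sub_le_sub_right (hy i ω hω) _)
    exact (norm_le_norm_sub_add _ _).trans (add_le_add_left hnorm _)
  | add ω ρ hω hρ =>
    obtain ⟨⟨C, hC⟩, D, hD⟩ := And.intro hω hρ
    refine ⟨C + D, fun i => ?_⟩
    rw [map_add]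
    exact (norm_add_le _ _).trans (add_le_add (hC i) (hD i))
  | smul c ω hω =>
    obtain ⟨C, hC⟩ := hω
    refine ⟨‖c‖ * C, fun i => ?_⟩
    rw [map_smul, norm_smul]
    exact mul_le_mul_of_nonneg_left (hC i) (norm_nonneg c)

theorem exists_tendsto_bidual_of_monotone [IsDirectedOrder ι] [Nonempty ι] {x : ι → Bidual A}
    (hx : Monotone x) {y : Bidual A} (hy : ∀ i, x i ≤ y) :
    ∃ z : Bidual A, ∀ ω, Tendsto (fun i => x i ω) atTop (𝓝 (z ω)) := by
  obtain ⟨i₀⟩ : Nonempty ι := inferInstance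
  obtain ⟨C, hC⟩ := banach_steinhaus (exists_norm_bidual_apply_le_of_monotone hx hy i₀)
  choose z hz using exists_tendsto_bidual_apply_of_monotone hx hy
  refine ⟨LinearMap.mkContinuous
    { toFun := z
      map_add' := fun ω ρ => tendsto_nhds_unique (hz (ω + ρ)) <| by
        simpa only [map_add] using (hz ω).add (hz ρ)
      map_smul' := fun c ω => tendsto_nhds_unique (hz (c • ω)) <| by
        simpa only [map_smul, RingHom.id_apply] using (hz ω).const_smul c } C fun ω => ?_, hz⟩
  refine le_of_tendsto (hz ω).norm ?_
  filter_upwards [eventually_ge_atTop i₀] with i hi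
  exact (x i).le_of_opNorm_le (hC ⟨i, hi⟩) ω

theorem scottContinuous_bidual_apply {ω : StrongDual ℂ A} (hω : IsPositiveMap ω) :
    ScottContinuous fun x : Bidual A => x ω := by
  intro D hne hD x hx
  have : Nonempty D := hne.to_subtype
  have : IsDirectedOrder D := directedOn_iff_isDirectedOrder.1 hD
  obtain ⟨z, hz⟩ := exists_tendsto_bidual_of_monotone (x := ((↑) : D → Bidual A))
    (fun _ _ h => h) fun d => hx.1 d.2
  have isLUB_z : ∀ ρ, IsPositiveMap ρ → IsLUB ((fun x : Bidual A => x ρ) '' D) (z ρ) :=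
    fun ρ hρ => by
      rw [Set.image_eq_range]
      exact isLUB_of_tendsto_atTop (f := fun d : D => (d : Bidual A) ρ) (fun _ _ h => h ρ hρ) (hz ρ)
  have hxz : x ≤ z := hx.2 fun d hd ρ hρ => (isLUB_z ρ hρ).1 ⟨d, hd, rfl⟩
  refine ⟨?_, fun c hc => (hxz ω hω).trans ((isLUB_z ω hω).2 hc)⟩
  rintro _ ⟨d, hd, rfl⟩
  exact hx.1 hd ω hω

theorem incl_monotone : Monotone (Bidual.incl : A → Bidual A) := fun _ _ h _ hω =>
  IsPositiveMap.monotone hω h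

end Bidual

end MonotoneConvergence

section NormalExtension

variable {H : Type*} [NormedAddCommGroup H] [InnerProductSpace ℂ H] [CompleteSpace H]
  {M : VonNeumannAlgebra H}

theorem vectorFunctional_mem_predual (ξ η : H) :
    (vectorFunctional ξ η : StrongDual ℂ M.Elem) ∈ M.predual := by
  have hs : ∀ ζ : H, Summable fun k : ℕ => ‖(Pi.single 0 ζ : ℕ → H) k‖ ^ 2 := fun ζ =>
    (hasSum_single 0 fun k hk => by
      rw [Pi.single_eq_of_ne hk, norm_zero, zero_pow two_ne_zero]).summable
  refine ⟨Pi.single 0 ξ, Pi.single 0 η, hs ξ, hs η, fun x => ?_⟩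
  have h := hasSum_single (f := fun k : ℕ => ⟪(Pi.single 0 ξ : ℕ → H) k,
    (x : H →L[ℂ] H) ((Pi.single 0 η : ℕ → H) k)⟫_ℂ) 0 fun k hk => by
      rw [Pi.single_eq_of_ne hk, inner_zero_left]
  rwa [Pi.single_eq_same, Pi.single_eq_same] at h

theorem hasSum_vectorFunctional {ω : StrongDual ℂ M.Elem} {ξ η : ℕ → H}
    (hξ : Summable fun k => ‖ξ k‖ ^ 2) (hη : Summable fun k => ‖η k‖ ^ 2)
    (h : ∀ x : M.Elem, HasSum (fun k => ⟪ξ k, (x : H →L[ℂ] H) (η k)⟫_ℂ) (ω x)) :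
    HasSum (fun k => (vectorFunctional (ξ k) (η k) : StrongDual ℂ M.Elem)) ω := by
  obtain ⟨ρ, hρ⟩ : Summable fun k => (vectorFunctional (ξ k) (η k) : StrongDual ℂ M.Elem) :=
    .of_norm_bounded (hξ.add hη) fun k => (norm_vectorFunctional_le _ _).trans <| by
      nlinarith [sq_nonneg (‖ξ k‖ - ‖η k‖), sq_nonneg ‖ξ k‖, sq_nonneg ‖η k‖]
  convert hρ
  ext x
  exact (h x).unique (hρ.mapL (ContinuousLinearMap.apply ℂ ℂ x))

theorem inner_normalExt (τ : M.Elem →L[ℂ] M.Elem) (x : Bidual M.Elem) (ξ η : H) :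
    ⟪ξ, (normalExt τ x : H →L[ℂ] H) η⟫_ℂ = x (vectorFunctional ξ η ∘L τ) :=
  inner_extOp τ x ξ η

theorem normalExt_incl (τ : M.Elem →L[ℂ] M.Elem) (a : M.Elem) :
    normalExt τ (Bidual.incl a) = τ a :=
  eq_of_forall_inner fun ξ η => inner_normalExt τ _ ξ η

theorem normalExt_injective :
    Function.Injective (normalExt : (M.Elem →L[ℂ] M.Elem) → Bidual M.Elem →L[ℂ] M.Elem) :=
  fun τ₁ τ₂ h => ContinuousLinearMap.ext fun a => by
    rw [← normalExt_incl, h, normalExt_incl]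

theorem normalExt_add (τ₁ τ₂ : M.Elem →L[ℂ] M.Elem) :
    normalExt (τ₁ + τ₂) = normalExt τ₁ + normalExt τ₂ := by
  ext1 x
  refine eq_of_forall_inner fun ξ η => ?_
  rw [inner_normalExt, ContinuousLinearMap.comp_add, map_add, ← inner_normalExt,
    ← inner_normalExt, ← inner_add_right]
  rfl

theorem normalExt_smul (c : ℂ) (τ : M.Elem →L[ℂ] M.Elem) :
    normalExt (c • τ) = c • normalExt τ := by
  ext1 x
  refine eq_of_forall_inner fun ξ η => ?_
  rw [inner_normalExt, ContinuousLinearMap.comp_smul, map_smul, ← inner_normalExt, smul_eq_mul,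
    ← inner_smul_right]
  rfl

theorem apply_comp_eq_normalExt (τ : M.Elem →L[ℂ] M.Elem) {ω : StrongDual ℂ M.Elem}
    (hω : ω ∈ M.predual) (x : Bidual M.Elem) : x (ω ∘L τ) = ω (normalExt τ x) := by
  obtain ⟨ξ, η, hξ, hη, h⟩ := hω
  have hsum := ((hasSum_vectorFunctional hξ hη h).mapL
    ((ContinuousLinearMap.compL ℂ M.Elem M.Elem ℂ).flip τ)).mapL x
  have hsum' := h (normalExt τ x)
  simp_rw [inner_normalExt] at hsum'
  exact hsum.unique hsum'

theorem scottContinuous_of_vectorFunctional {α : Type*} [Preorder α] {T : α → M.Elem}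
    (hT : ∀ ξ : H, ScottContinuous fun a => vectorFunctional ξ ξ (T a)) : ScottContinuous T := by
  intro D hne hD x hx
  refine ⟨?_, fun c hc => le_iff.2 fun ξ => (hT ξ hne hD hx).2 ?_⟩
  · rintro _ ⟨d, hd, rfl⟩
    exact le_iff.2 fun ξ => (hT ξ).monotone (hx.1 hd)
  · rintro _ ⟨d, hd, rfl⟩
    exact le_iff.1 (hc ⟨d, hd, rfl⟩) ξ

theorem exists_tendsto_predual_of_monotone {ι : Type*} [Preorder ι] [IsDirectedOrder ι]
    [Nonempty ι] {f : ι → M.Elem} (hf : Monotone f) {b : M.Elem} (hb : ∀ i, f i ≤ b) :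
    ∃ y, ∀ ω ∈ M.predual, Tendsto (fun i => ω (f i)) atTop (𝓝 (ω y)) := by
  obtain ⟨z, hz⟩ := exists_tendsto_bidual_of_monotone (incl_monotone.comp hf)
    fun i => incl_monotone (hb i)
  refine ⟨normalExt (.id ℂ _) z, fun ω hω => ?_⟩
  rw [← apply_comp_eq_normalExt _ hω, ContinuousLinearMap.comp_id]
  exact hz ω

theorem isLUB_range_of_tendsto {ι : Type*} [Preorder ι] [IsDirectedOrder ι] [Nonempty ι]
    {f : ι → M.Elem} (hf : Monotone f) {y : M.Elem}
    (hy : ∀ ω ∈ M.predual, Tendsto (fun i => ω (f i)) atTop (𝓝 (ω y))) :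
    IsLUB (Set.range f) y := by
  have isLUB_inner : ∀ ξ, IsLUB (Set.range fun i => vectorFunctional ξ ξ (f i))
      (vectorFunctional ξ ξ y) := fun ξ =>
    isLUB_of_tendsto_atTop (fun _ _ h => le_iff.1 (hf h) ξ)
      (hy _ (vectorFunctional_mem_predual ξ ξ))
  refine ⟨Set.forall_mem_range.2 fun i => le_iff.2 fun ξ => (isLUB_inner ξ).1 ⟨i, rfl⟩,
    fun c hc => le_iff.2 fun ξ => (isLUB_inner ξ).2 ?_⟩
  exact Set.forall_mem_range.2 fun i => le_iff.1 (hc ⟨i, rfl⟩) ξ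

theorem exists_isLUB_range_of_monotone {ι : Type*} [Preorder ι] [IsDirectedOrder ι]
    [Nonempty ι] {f : ι → M.Elem} (hf : Monotone f) {b : M.Elem} (hb : ∀ i, f i ≤ b) :
    ∃ y, IsLUB (Set.range f) y :=
  (exists_tendsto_predual_of_monotone hf hb).imp fun _ => isLUB_range_of_tendsto hf

theorem scottContinuous_of_mem_predual {ω : StrongDual ℂ M.Elem} (hω : ω ∈ M.predual)
    (hpos : IsPositiveMap ω) : ScottContinuous ω := by
  refine scottContinuous_complex_iff.2 ⟨hpos.monotone, fun D hne hD x hx => ?_⟩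
  have : Nonempty D := hne.to_subtype
  have : IsDirectedOrder D := directedOn_iff_isDirectedOrder.1 hD
  have hmono : Monotone ((↑) : D → M.Elem) := fun _ _ h => h
  obtain ⟨y, hy⟩ := exists_tendsto_predual_of_monotone hmono fun d => hx.1 d.2
  have hxy : IsLUB D y := by simpa only [Subtype.range_coe] using isLUB_range_of_tendsto hmono hy
  rw [hx.unique hxy]
  exact hy ω hω

theorem scottContinuous_vectorFunctional (ξ : H) :
    ScottContinuous (vectorFunctional ξ ξ : StrongDual ℂ M.Elem) :=
  scottContinuous_of_mem_predual (vectorFunctional_mem_predual ξ ξ)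
    (vectorFunctional_self_isPositiveMap ξ)

theorem isPositiveMap_of_isCP {τ : M.Elem →L[ℂ] M.Elem} (hτ : IsCP τ) : IsPositiveMap τ :=
  fun a ha => nonneg_iff.2 fun ξ => by
    simpa using hτ 1 (.of fun _ _ => a) (fun η => by simpa using nonneg_iff.1 ha (η 0)) fun _ => ξ

theorem IsPositiveMap.vectorFunctional_comp {τ : M.Elem →L[ℂ] M.Elem} (hτ : IsPositiveMap τ)
    (ξ : H) : IsPositiveMap (vectorFunctional ξ ξ ∘L τ) :=
  fun _ ha => nonneg_iff.1 (hτ _ ha) ξ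

theorem isBidualCP_normalExt {τ : M.Elem →L[ℂ] M.Elem} (hτ : IsCP τ) :
    IsBidualCP (normalExt τ) := by
  intro n x hx ξ
  simp only [Matrix.map_apply, inner_normalExt]
  exact hx (fun i j => vectorFunctional (ξ i) (ξ j) ∘L τ) fun a ha => hτ n a ha ξ

theorem scottContinuous_normalExt {τ : M.Elem →L[ℂ] M.Elem} (hτ : IsPositiveMap τ) :
    ScottContinuous (normalExt τ) :=
  scottContinuous_of_vectorFunctional fun ξ => by
    simp only [vectorFunctional_apply, inner_normalExt]
    exact scottContinuous_bidual_apply (hτ.vectorFunctional_comp ξ)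

theorem isNormalExt_normalExt {τ : M.Elem →L[ℂ] M.Elem} (hτ : τ ∈ CP M) :
    IsNormalExt τ (normalExt τ) where
  cp := isBidualCP_normalExt hτ.1
  map_one := (normalExt_incl τ 1).trans hτ.2
  normal := scottContinuous_normalExt (isPositiveMap_of_isCP hτ.1)
  duality _ hω x := apply_comp_eq_normalExt τ hω x

theorem eq_normalExt_of_isNormalExt {τ : M.Elem →L[ℂ] M.Elem} {T : Bidual M.Elem →L[ℂ] M.Elem}
    (hT : IsNormalExt τ T) : T = normalExt τ := by
  ext1 x
  refine eq_of_forall_inner fun ξ η => ?_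
  rw [inner_normalExt, hT.duality _ (vectorFunctional_mem_predual ξ η), vectorFunctional_apply]

end NormalExtension

section PositiveForms

theorem star_apply_eq_of_nonneg {E : Type*} [AddCommGroup E] [Module ℂ E]
    (B : E →ₗ⋆[ℂ] E →ₗ[ℂ] ℂ) (hB : ∀ x, 0 ≤ B x x) (x y : E) : star (B y x) = B x y := by
  have him : ∀ x, (B x x).im = 0 := fun x => ((Complex.nonneg_iff.1 (hB x)).2).symm
  have h₁ : (B x y).im + (B y x).im = 0 := by
    simpa [him, add_comm] using him (x + y)
  have h₂ : (B x y).re - (B y x).re = 0 := by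
    simpa [him, sub_eq_add_neg] using him (x + Complex.I • y)
  exact Complex.ext (by simp; linarith) (by simp; linarith)

universe u

theorem exists_hilbertSpace_of_nonneg {E : Type u} [AddCommGroup E] [Module ℂ E]
    (B : E →ₗ⋆[ℂ] E →ₗ[ℂ] ℂ) (hB : ∀ x, 0 ≤ B x x) :
    ∃ (K : Type u) (_ : NormedAddCommGroup K) (_ : InnerProductSpace ℂ K) (_ : CompleteSpace K)
      (J : E →ₗ[ℂ] K), DenseRange J ∧ ∀ x y, ⟪J x, J y⟫_ℂ = B x y := by
  let core : PreInnerProductSpace.Core ℂ E :=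
    { inner := fun x y => B x y
      conj_inner_symm := star_apply_eq_of_nonneg B hB
      re_inner_nonneg := fun x => (Complex.nonneg_iff.1 (hB x)).1
      add_left := fun x y z => by simp
      smul_left := fun x y r => by simp }
  let : SeminormedAddCommGroup E :=
    InnerProductSpace.Core.toSeminormedAddCommGroup (𝕜 := ℂ) (c := core)
  let : InnerProductSpace ℂ E := .ofCore core
  exact ⟨UniformSpace.Completion E, inferInstance, inferInstance, inferInstance,
    UniformSpace.Completion.toComplL.toLinearMap, UniformSpace.Completion.denseRange_coe,
    fun x y => UniformSpace.Completion.inner_coe x y⟩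

variable {E : Type u} [NormedAddCommGroup E] [NormedSpace ℂ E]

theorem exists_vector_bidual_apply_eq_inner {K : Type*}
    [NormedAddCommGroup K] [InnerProductSpace ℂ K] [CompleteSpace K] (J : E →L[ℂ] K)
    (z : StrongDual ℂ (StrongDual ℂ E)) :
    ∃ v : K, ∀ u, z (innerSL ℂ u ∘L J) = ⟪u, v⟫_ℂ := by
  let f : StrongDual ℂ K := LinearMap.mkContinuous
    { toFun := fun u => star (z (innerSL ℂ u ∘L J))
      map_add' := fun u w => by simp
      map_smul' := fun c u => by simp } (‖z‖ * ‖J‖) fun u => by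
    calc ‖star (z (innerSL ℂ u ∘L J))‖ = ‖z (innerSL ℂ u ∘L J)‖ := norm_star _
      _ ≤ ‖z‖ * (‖innerSL ℂ u‖ * ‖J‖) := z.le_opNorm_of_le (ContinuousLinearMap.opNorm_comp_le _ _)
      _ = ‖z‖ * ‖J‖ * ‖u‖ := by rw [innerSL_apply_norm]; ring
  refine ⟨(InnerProductSpace.toDual ℂ K).symm f, fun u => ?_⟩
  rw [← inner_conj_symm, InnerProductSpace.toDual_symm_apply]
  exact (star_star _).symm

variable (B : E →L⋆[ℂ] E →L[ℂ] ℂ) (hB : ∀ x, 0 ≤ B x x) (z : StrongDual ℂ (StrongDual ℂ E))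
  {θ : StrongDual ℂ E} (hθ : ∀ x, θ x = star (z (B x)))
include hB hθ

theorem exists_hilbertSpace_vector :
    ∃ (K : Type u) (_ : NormedAddCommGroup K) (_ : InnerProductSpace ℂ K) (J : E → K) (v : K),
      DenseRange J ∧ (∀ x, ⟪J x, J x⟫_ℂ = B x x) ∧ (∀ x, ⟪J x, v⟫_ℂ = z (B x)) ∧
      ⟪v, v⟫_ℂ = z θ := by
  obtain ⟨K, _, _, _, J₀, hJ, hJB⟩ := exists_hilbertSpace_of_nonneg
    (ContinuousLinearMap.coeLMₛₗ (RingHom.id ℂ) ∘ₛₗ B.toLinearMap) hB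
  have norm_J_le : ∀ x, ‖J₀ x‖ ≤ √‖B‖ * ‖x‖ := fun x => by
    refine le_of_sq_le_sq ?_ (by positivity)
    calc ‖J₀ x‖ ^ 2 = ‖B x x‖ := by
          rw [← inner_self_eq_norm_sq (𝕜 := ℂ), inner_self_re_eq_norm, hJB]
          rfl
      _ ≤ ‖B‖ * ‖x‖ * ‖x‖ := B.le_opNorm₂ x x
      _ = (√‖B‖ * ‖x‖) ^ 2 := by rw [mul_pow, Real.sq_sqrt (norm_nonneg B)]; ring
  let J : E →L[ℂ] K := J₀.mkContinuous _ norm_J_le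
  obtain ⟨v, hv⟩ := exists_vector_bidual_apply_eq_inner J z
  have inner_J_v : ∀ x, ⟪J x, v⟫_ℂ = z (B x) := fun x => by
    rw [← hv]
    congr 1
    ext y
    exact hJB x y
  refine ⟨K, _, inferInstance, J, v, hJ, fun x => hJB x x, inner_J_v, ?_⟩
  rw [← hv]
  congr 1
  ext x
  rw [hθ, ← inner_J_v]
  exact (inner_conj_symm v (J x)).symm

theorem bidual_apply_nonneg : 0 ≤ z θ := by
  obtain ⟨K, _, _, -, v, -, -, -, hv⟩ := exists_hilbertSpace_vector B hB z hθ
  rw [← hv, inner_self_eq_norm_sq_to_K]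
  exact pow_nonneg (Complex.zero_le_real.2 (norm_nonneg v)) 2

theorem exists_re_sub_lt {δ : ℝ} (hδ : 0 < δ) :
    ∃ x, (B x x - z (B x) - star (z (B x)) + z θ).re < δ := by
  obtain ⟨K, _, _, J, v, hJ, hJB, hBv, hv⟩ := exists_hilbertSpace_vector B hB z hθ
  obtain ⟨x, hx⟩ := hJ.exists_dist_lt v (Real.sqrt_pos.2 hδ)
  rw [dist_comm, dist_eq_norm, Real.lt_sqrt (norm_nonneg _)] at hx
  refine ⟨x, lt_of_eq_of_lt ?_ hx⟩
  rw [← inner_self_eq_norm_sq (𝕜 := ℂ), inner_sub_sub_self, hJB, hBv, hv,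
    ← hBv, ← inner_conj_symm v (J x)]
  rfl

end PositiveForms

section ArensProduct

open Bidual

variable {A : Type*} [NormedRing A] [NormedAlgebra ℂ A]

theorem act_mul (x y : Bidual A) (ω : StrongDual ℂ A) : (x * y).act ω = x.act (y.act ω) := by
  ext a
  rw [act_apply, act_apply, mul_apply]
  congr 1
  ext b
  rw [act_apply, rightAct_apply, act_apply]
  congr 1
  ext c
  simp only [rightAct_apply, mul_assoc]

theorem incl_mul_apply (a : A) (x : Bidual A) (ω : StrongDual ℂ A) :
    (incl a * x) ω = x.act ω a := rfl

theorem incl_mul (a b : A) : incl (a * b) = incl a * incl b := rfl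

theorem act_apply_one (x : Bidual A) (ω : StrongDual ℂ A) : x.act ω 1 = x ω := by
  rw [act_apply]
  congr 1
  ext a
  rw [rightAct_apply, one_mul]

theorem one_act (ω : StrongDual ℂ A) : (1 : Bidual A).act ω = ω := by
  ext a
  exact congrArg ω (mul_one a)

scoped instance : Ring (Bidual A) where
  __ := (inferInstance : AddCommGroup (Bidual A))
  __ := instMul
  __ := instOne
  mul_assoc x y w := by
    ext ω
    simp only [mul_apply, act_mul]
  one_mul x := by
    ext ω
    exact act_apply_one x ω
  mul_one x := by
    ext ω
    rw [mul_apply, one_act]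
  left_distrib x y w := by
    ext ω
    exact map_add x (y.act ω) (w.act ω)
  right_distrib x y w := rfl
  zero_mul x := rfl
  mul_zero x := ContinuousLinearMap.ext fun _ => map_zero x

theorem one_sub_act (x : Bidual A) (ω : StrongDual ℂ A) : (1 - x).act ω = ω - x.act ω := by
  calc (1 - x).act ω = (1 : Bidual A).act ω - x.act ω := rfl
    _ = ω - x.act ω := by rw [one_act]

end ArensProduct

section CentralProjection

open Bidual

variable {A : Type*} [NormedRing A] [NormedAlgebra ℂ A] [StarRing A] [NormedStarGroup A]
  [StarModule ℂ A]

/-- A central projection of `A**`, without the identification of its range in `A*` that is part of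
`IsNormalProjection`; both `z₀` and `1 - z₀` are of this kind. -/
structure IsCentralProjection (z : Bidual A) : Prop extends IsStarProjection z where
  commute : ∀ x, Commute z x

theorem dualStar_dualStar (ω : StrongDual ℂ A) : dualStar (dualStar ω) = ω := by
  ext a
  simp only [dualStar_apply, star_star]

theorem star_one_sub (z : Bidual A) : star (1 - z) = 1 - star z := by
  ext ω
  change star (star (ω (star 1)) - z (dualStar ω)) = ω 1 - star (z (dualStar ω))
  rw [star_sub, star_star, star_one]

variable {z : Bidual A}

theorem apply_dualStar (hz : IsSelfAdjoint z) (ω : StrongDual ℂ A) :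
    z (dualStar ω) = star (z ω) := by
  rw [← dualStar_dualStar ω, ← star_apply, hz.star_eq, dualStar_dualStar]

theorem IsCentralProjection.one_sub (hz : IsCentralProjection z) :
    IsCentralProjection (1 - z) where
  isIdempotentElem := hz.isIdempotentElem.one_sub
  isSelfAdjoint := (star_one_sub z).trans (by rw [hz.isSelfAdjoint.star_eq])
  commute x := (Commute.one_left x).sub_left (hz.commute x)

theorem IsCentralProjection.act_act (hz : IsCentralProjection z) (ω : StrongDual ℂ A) :
    z.act (z.act ω) = z.act ω := by
  rw [← act_mul, hz.isIdempotentElem.eq]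

theorem IsCentralProjection.one_sub_act_act (hz : IsCentralProjection z) (ω : StrongDual ℂ A) :
    z.act ((1 - z).act ω) = 0 := by
  rw [one_sub_act, map_sub, hz.act_act, sub_self]

/-- The form `(x, y) ↦ φ (x⋆ a y)` on `A`. In its Hilbert space an element of `A**` becomes a
vector, which transports positivity from `A` to `A**`. -/
def conjForm (φ : StrongDual ℂ A) (a : A) : A →L⋆[ℂ] A →L[ℂ] ℂ :=
  (rightAct φ ∘L (ContinuousLinearMap.mul ℂ A).flip a) ∘SL
    ((starL ℂ : A ≃L⋆[ℂ] A) : A →L⋆[ℂ] A)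

theorem conjForm_apply (φ : StrongDual ℂ A) (a x y : A) :
    conjForm φ a x y = φ (star x * a * y) := rfl

/-- The form `(x, y) ↦ ψ (y x⋆)` on `A`, by which `ψ (b b⋆)` is made small by Hilbert space
approximation. -/
def conjFormRight (ψ : StrongDual ℂ A) : A →L⋆[ℂ] A →L[ℂ] ℂ :=
  (ContinuousLinearMap.compL ℂ A A ℂ ψ ∘L (ContinuousLinearMap.mul ℂ A).flip) ∘SL
    ((starL ℂ : A ≃L⋆[ℂ] A) : A →L⋆[ℂ] A)

theorem IsCentralProjection.sum_incl_mul_apply_nonneg (hz : IsCentralProjection z) {ι : Type*}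
    [Fintype ι] {φ : ι → StrongDual ℂ A} {a : ι → A}
    (h : ∀ x, 0 ≤ ∑ i, φ i (star x * a i * x)) : 0 ≤ ∑ i, (incl (a i) * z) (φ i) := by
  let ρ : StrongDual ℂ A := ∑ i, (incl (a i) * z).act (φ i)
  have hzρ : z ρ = ∑ i, (incl (a i) * z) (φ i) := by
    rw [map_sum]
    refine Finset.sum_congr rfl fun i _ => ?_
    rw [← mul_apply, (hz.commute _).eq, mul_assoc, hz.isIdempotentElem.eq]
  have key : 0 ≤ z (dualStar ρ) := by
    refine bidual_apply_nonneg (∑ i, conjForm (φ i) (a i)) (fun x => ?_) z fun x => ?_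
    · simpa [conjForm_apply] using h x
    · simp only [ρ, dualStar_apply, sum_apply, map_sum]
      congr! 2 with i
      rw [← incl_mul_apply, ← mul_assoc, ← incl_mul]
      rfl
  rwa [apply_dualStar hz.isSelfAdjoint, star_nonneg_iff, hzρ] at key

end CentralProjection

section Approximation

open Bidual

variable {A : Type*} [CStarAlgebra A] [PartialOrder A] [StarOrderedRing A]

theorem IsCentralProjection.exists_approx {z : Bidual A} (hz : IsCentralProjection z)
    {ψ ω : StrongDual ℂ A} (hψ : IsPositiveMap ψ) (hω : IsPositiveMap ω) (hzψ : z.act ψ = 0)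
    (hzω : z.act ω = ω) {δ : ℝ} (hδ : 0 < δ) :
    ∃ b, (ψ (b * star b)).re + (ω (star (1 - b) * (1 - b))).re < δ := by
  let B := conjFormRight ψ + conjForm ω 1
  have hB : ∀ x y, B x y = ψ (y * star x) + ω (star x * y) := fun x y => by
    change ψ (y * star x) + ω (star x * 1 * y) = _
    rw [mul_one]
  have hBpos : ∀ x, 0 ≤ B x x := fun x => by
    rw [hB]
    exact add_nonneg (hψ _ (mul_star_self_nonneg x)) (hω _ (star_mul_self_nonneg x))
  have hzB : ∀ x, z (B x) = ω (star x) := fun x =>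
    calc z (B x) = (z * incl (star x)) ψ + z.act ω (star x * 1) := map_add z _ _
      _ = ω (star x) := by
        rw [(hz.commute _).eq, incl_mul_apply, hzψ, hzω, mul_one]
        exact zero_add _
  obtain ⟨b, hb⟩ := exists_re_sub_lt B hBpos z (θ := ω)
    (fun x => by rw [hzB, hω.map_star, star_star]) hδ
  refine ⟨b, lt_of_eq_of_lt ?_ hb⟩
  rw [← Complex.add_re, hB, hzB, ← hω.map_star, star_star, ← act_apply_one z ω, hzω]
  congr 1
  simp only [star_sub, star_one, sub_mul, mul_sub, one_mul, mul_one, map_sub]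
  ring

end Approximation

section NormalPart

open Bidual

variable {H : Type*} [NormedAddCommGroup H] [InnerProductSpace ℂ H] [CompleteSpace H]
  {M : VonNeumannAlgebra H}

section IsNormalProjection

variable {z₀ : Bidual M.Elem} (hz₀ : IsNormalProjection z₀)
include hz₀

theorem isCentralProjection_of_isNormalProjection : IsCentralProjection z₀ where
  toIsStarProjection := hz₀.isStarProjection
  commute := hz₀.central

theorem act_mem_predual (ω : StrongDual ℂ M.Elem) : z₀.act ω ∈ M.predual := by
  rw [← hz₀.range_act]
  exact ⟨ω, rfl⟩

theorem act_eq_self_of_mem_predual {ω : StrongDual ℂ M.Elem} (hω : ω ∈ M.predual) :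
    z₀.act ω = ω := by
  rw [← hz₀.range_act] at hω
  obtain ⟨ρ, rfl⟩ := hω
  exact (isCentralProjection_of_isNormalProjection hz₀).act_act ρ

end IsNormalProjection

/-- The map `a ↦ τ̃(i(a) z)`, whose dual is `ω ↦ z(ωτ)`. For `z = z₀` it is the normal part of `τ`,
and for `z = 1 - z₀` the singular part, neither of them normalized to be unital. -/
def cutoff (τ : M.Elem →L[ℂ] M.Elem) (z : Bidual M.Elem) : M.Elem →L[ℂ] M.Elem :=
  normalExt τ ∘L z.act.flip

theorem cutoff_apply (τ : M.Elem →L[ℂ] M.Elem) (z : Bidual M.Elem) (a : M.Elem) :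
    cutoff τ z a = normalExt τ (incl a * z) := rfl

theorem cutoff_apply_one (τ : M.Elem →L[ℂ] M.Elem) (z : Bidual M.Elem) :
    cutoff τ z 1 = normalExt τ z := by
  rw [cutoff_apply]
  exact congrArg _ (one_mul z)

theorem cutoff_add_cutoff_one_sub (τ : M.Elem →L[ℂ] M.Elem) (z : Bidual M.Elem) :
    cutoff τ z + cutoff τ (1 - z) = τ := by
  ext1 a
  rw [add_apply, cutoff_apply, cutoff_apply, ← map_add, ← mul_add, add_sub_cancel, mul_one,
    normalExt_incl]

theorem comp_cutoff (τ : M.Elem →L[ℂ] M.Elem) (z : Bidual M.Elem) {ω : StrongDual ℂ M.Elem}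
    (hω : ω ∈ M.predual) : ω ∘L cutoff τ z = z.act (ω ∘L τ) := by
  ext a
  rw [ContinuousLinearMap.comp_apply, cutoff_apply, ← apply_comp_eq_normalExt τ hω,
    incl_mul_apply]

theorem normalExt_cutoff (τ : M.Elem →L[ℂ] M.Elem) (z w : Bidual M.Elem) :
    normalExt (cutoff τ z) w = normalExt τ (w * z) :=
  eq_of_forall_inner fun ξ η => by
    rw [inner_normalExt, inner_normalExt, comp_cutoff τ z (vectorFunctional_mem_predual ξ η),
      mul_apply]

theorem isPosMatrix_star_mul_mul {n : ℕ} {a : Matrix (Fin n) (Fin n) M.Elem} (ha : IsPosMatrix a)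
    (x : M.Elem) : IsPosMatrix (a.map fun b => star x * b * x) := fun ξ => by
  have h := ha fun i => (x : H →L[ℂ] H) (ξ i)
  simpa [ContinuousLinearMap.star_eq_adjoint, ContinuousLinearMap.adjoint_inner_right] using h

theorem isCP_cutoff {τ : M.Elem →L[ℂ] M.Elem} (hτ : IsCP τ) {z : Bidual M.Elem}
    (hz : IsCentralProjection z) : IsCP (cutoff τ z) := by
  intro n a ha ξ
  have key := hz.sum_incl_mul_apply_nonneg (ι := Fin n × Fin n)
    (φ := fun i => vectorFunctional (ξ i.1) (ξ i.2) ∘L τ) (a := fun i => a i.1 i.2) fun x => by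
      rw [Fintype.sum_prod_type]
      exact hτ n _ (isPosMatrix_star_mul_mul ha x) ξ
  simpa only [Matrix.map_apply, cutoff_apply, inner_normalExt, Fintype.sum_prod_type] using key

theorem isCP_smul {τ : M.Elem →L[ℂ] M.Elem} (hτ : IsCP τ) {r : ℝ} (hr : 0 ≤ r) :
    IsCP ((r : ℂ) • τ) := by
  intro n a ha ξ
  have h := mul_nonneg (Complex.zero_le_real.2 hr) (hτ n a ha ξ)
  simpa [inner_smul_right, Finset.mul_sum] using h

theorem scottContinuous_cutoff {τ : M.Elem →L[ℂ] M.Elem} (hτ : IsCP τ) {z₀ : Bidual M.Elem}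
    (hz₀ : IsNormalProjection z₀) : ScottContinuous (cutoff τ z₀) :=
  scottContinuous_of_vectorFunctional fun ξ => by
    have hω : vectorFunctional ξ ξ ∘L cutoff τ z₀ ∈ M.predual := by
      rw [comp_cutoff τ z₀ (vectorFunctional_mem_predual ξ ξ)]
      exact act_mem_predual hz₀ _
    exact scottContinuous_of_mem_predual hω <| IsPositiveMap.vectorFunctional_comp
      (isPositiveMap_of_isCP (isCP_cutoff hτ (isCentralProjection_of_isNormalProjection hz₀))) ξ

end NormalPart

section Damping

variable {A : Type*} [CStarAlgebra A]

/-- The bounded increasing transform `a ↦ 1 - (1 + a)⁻¹` of positive elements, by which unbounded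
sums of positive elements are brought into the unit interval. -/
def damp (a : A) : A := 1 - Ring.inverse (1 + a)

theorem one_sub_damp (a : A) : 1 - damp a = Ring.inverse (1 + a) := sub_sub_cancel _ _

theorem damp_zero : damp (0 : A) = 0 := by
  rw [damp, add_zero, Ring.inverse_one, sub_self]

variable [PartialOrder A] [StarOrderedRing A]

theorem isStrictlyPositive_one_add {a : A} (ha : 0 ≤ a) : IsStrictlyPositive (1 + a) :=
  isStrictlyPositive_one.add_nonneg ha

theorem ringInverse_one_add_nonneg {a : A} (ha : 0 ≤ a) : 0 ≤ Ring.inverse (1 + a) :=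
  (isStrictlyPositive_one_add ha).ringInverse.nonneg

theorem damp_le_one {a : A} (ha : 0 ≤ a) : damp a ≤ 1 :=
  sub_le_self _ (ringInverse_one_add_nonneg ha)

theorem damp_mono {a b : A} (ha : 0 ≤ a) (hab : a ≤ b) : damp a ≤ damp b :=
  sub_le_sub_left (CStarAlgebra.ringInverse_le_ringInverse (add_le_add_right hab 1)
    (isStrictlyPositive_one_add ha)) _

theorem damp_nonneg {a : A} (ha : 0 ≤ a) : 0 ≤ damp a :=
  damp_zero.symm.trans_le (damp_mono le_rfl ha)

theorem damp_eq_mul_inverse {a : A} (ha : 0 ≤ a) : damp a = a * Ring.inverse (1 + a) := by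
  rw [damp, sub_eq_iff_eq_add', ← one_add_mul,
    Ring.mul_inverse_cancel _ (isStrictlyPositive_one_add ha).isUnit]

theorem damp_eq_inverse_mul {a : A} (ha : 0 ≤ a) : damp a = Ring.inverse (1 + a) * a := by
  rw [damp, sub_eq_iff_eq_add', ← mul_one_add,
    Ring.inverse_mul_cancel _ (isStrictlyPositive_one_add ha).isUnit]

theorem damp_le_self {a : A} (ha : 0 ≤ a) : damp a ≤ a := by
  have h : a - damp a = a * Ring.inverse (1 + a) * a := by
    rw [mul_assoc, ← damp_eq_inverse_mul ha, damp, mul_sub, mul_one, ← damp_eq_mul_inverse ha, damp]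
  rw [← sub_nonneg, h]
  exact (IsSelfAdjoint.of_nonneg ha).conjugate_nonneg (ringInverse_one_add_nonneg ha)

theorem mul_self_le_self {c : A} (hc0 : 0 ≤ c) (hc1 : c ≤ 1) : c * c ≤ c := by
  simpa only [sq, pow_one] using CStarAlgebra.pow_antitone hc0 hc1 one_le_two

theorem star_add_mul_self_le (x y : A) :
    star (x + y) * (x + y) ≤ 2 • (star x * x) + 2 • (star y * y) := by
  rw [← sub_nonneg]
  convert star_mul_self_nonneg (x - y) using 1
  simp only [star_add, star_sub, add_mul, sub_mul, mul_add, mul_sub]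
  abel

theorem le_smul_one_add_smul_sq {R : A} (hR : IsSelfAdjoint R) {s : ℝ} (hs : 0 < s) :
    R ≤ s • 1 + (4 * s)⁻¹ • (R * R) := by
  have h := smul_nonneg (inv_nonneg.2 (by positivity : 0 ≤ 4 * s))
    ((hR.sub (.smul (.all (2 * s)) (.one A))).mul_self_nonneg)
  rw [← sub_nonneg]
  convert h using 1
  simp only [sub_mul, mul_sub, mul_smul_comm, smul_mul_assoc, mul_one, one_mul, smul_sub,
    smul_smul]
  match_scalars <;> field_simp <;> norm_num

theorem star_mul_self_le_of_mul_star_self_le {y : A} {r : ℝ} (hr : 0 ≤ r)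
    (h : y * star y ≤ r • 1) : star y * y ≤ r • 1 := by
  rw [← Algebra.algebraMap_eq_smul_one] at h ⊢
  rw [← CStarAlgebra.norm_le_iff_le_algebraMap _ hr (mul_star_self_nonneg y),
    CStarRing.norm_self_mul_star] at h
  rwa [← CStarAlgebra.norm_le_iff_le_algebraMap _ hr (star_mul_self_nonneg y),
    CStarRing.norm_star_mul_self]

theorem inverse_one_add_mul_mul_inverse_le_one {a : A} (ha : 0 ≤ a) :
    Ring.inverse (1 + a) * a * Ring.inverse (1 + a) ≤ 1 := by
  have h : Ring.inverse (1 + a) * a * Ring.inverse (1 + a) = damp a - damp a * damp a := by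
    rw [← damp_eq_inverse_mul ha, ← one_sub_damp, mul_sub, mul_one]
  rw [h]
  exact (sub_le_self _ (IsSelfAdjoint.of_nonneg (damp_nonneg ha)).mul_self_nonneg).trans
    (damp_le_one ha)

-- With `R = (1 + a)⁻¹`, split `R = R b + R (1 - b)` in the bound `R ≤ s + R² / (4 s)`.
theorem one_sub_damp_le {s : ℝ} (hs : 0 < s) (b : A) :
    1 - damp ((s ^ 2)⁻¹ • (b * star b)) ≤
      (3 / 2 * s) • 1 + (2 * s)⁻¹ • (star (1 - b) * (1 - b)) := by
  set a := (s ^ 2)⁻¹ • (b * star b) with ha_def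
  have ha : 0 ≤ a := smul_nonneg (by positivity) (mul_star_self_nonneg b)
  rw [one_sub_damp]
  set R := Ring.inverse (1 + a)
  have hR0 : 0 ≤ R := ringInverse_one_add_nonneg ha
  have hR1 : R ≤ 1 := sub_nonneg.1 (damp_nonneg ha)
  have hR : IsSelfAdjoint R := .of_nonneg hR0
  have hRb : star (R * b) * (R * b) ≤ s ^ 2 • 1 := by
    refine star_mul_self_le_of_mul_star_self_le (sq_nonneg s) ?_
    have h : R * b * star (R * b) = s ^ 2 • (R * a * R) := by
      rw [ha_def, mul_smul_comm, smul_mul_assoc, smul_inv_smul₀ (by positivity), star_mul,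
        hR.star_eq, mul_assoc, mul_assoc, mul_assoc]
    rw [h]
    exact smul_le_smul_of_nonneg_left (inverse_one_add_mul_mul_inverse_le_one ha) (sq_nonneg s)
  have hRb' : star (R * (1 - b)) * (R * (1 - b)) ≤ star (1 - b) * (1 - b) :=
    calc _ = star (1 - b) * (R * R) * (1 - b) := by
          rw [star_mul, hR.star_eq, mul_assoc, mul_assoc, mul_assoc]
      _ ≤ star (1 - b) * 1 * (1 - b) := star_left_conjugate_le_conjugate
          ((mul_self_le_self hR0 hR1).trans hR1) _
      _ = star (1 - b) * (1 - b) := by rw [mul_one]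
  have hsq : R * R ≤ 2 • s ^ 2 • (1 : A) + 2 • (star (1 - b) * (1 - b)) :=
    calc R * R = star (R * b + R * (1 - b)) * (R * b + R * (1 - b)) := by
          rw [← mul_add, add_sub_cancel, mul_one, hR.star_eq]
      _ ≤ _ := (star_add_mul_self_le _ _).trans (by gcongr)
  calc R ≤ s • 1 + (4 * s)⁻¹ • (R * R) := le_smul_one_add_smul_sq hR hs
    _ ≤ s • 1 + (4 * s)⁻¹ • (2 • s ^ 2 • (1 : A) + 2 • (star (1 - b) * (1 - b))) := by gcongr
    _ = _ := by match_scalars <;> field_simp <;> norm_num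

theorem IsCentralProjection.exists_damp_approx {z : Bidual A} (hz : IsCentralProjection z)
    {ψ ω : StrongDual ℂ A} (hψ : IsPositiveMap ψ) (hω : IsPositiveMap ω) (hzψ : z.act ψ = 0)
    (hzω : z.act ω = ω) {ε : ℝ} (hε : 0 < ε) :
    ∃ a, 0 ≤ a ∧ ψ a ≤ ε ∧ ω (1 - damp a) ≤ ε := by
  obtain ⟨K, hK0, hK⟩ : ∃ K ≥ (0 : ℝ), (K : ℂ) = ω 1 :=
    RCLike.nonneg_iff_exists_ofReal.1 (hω 1 zero_le_one)
  set s := ε / (3 * (K + 1)) with hs_def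
  have hs : 0 < s := by positivity
  have hsK : 3 / 2 * s * K ≤ ε / 2 := by
    rw [hs_def]
    field_simp
    linarith
  obtain ⟨b, hb⟩ := hz.exists_approx hψ hω hzψ hzω (δ := min (s ^ 2 * ε) (s * ε)) (by positivity)
  obtain ⟨p, hp0, hp⟩ : ∃ p ≥ (0 : ℝ), (p : ℂ) = ψ (b * star b) :=
    RCLike.nonneg_iff_exists_ofReal.1 (hψ _ (mul_star_self_nonneg b))
  obtain ⟨q, hq0, hq⟩ : ∃ q ≥ (0 : ℝ), (q : ℂ) = ω (star (1 - b) * (1 - b)) :=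
    RCLike.nonneg_iff_exists_ofReal.1 (hω _ (star_mul_self_nonneg _))
  rw [← hp, ← hq, Complex.ofReal_re, Complex.ofReal_re, lt_min_iff] at hb
  refine ⟨(s ^ 2)⁻¹ • (b * star b), smul_nonneg (by positivity) (mul_star_self_nonneg b), ?_, ?_⟩
  · rw [ContinuousLinearMap.map_smul_of_tower, ← hp, Complex.real_smul]
    norm_cast
    rw [inv_mul_le_iff₀ (by positivity)]
    linarith
  · refine (hω.monotone (one_sub_damp_le hs b)).trans ?_
    rw [map_add, ContinuousLinearMap.map_smul_of_tower, ContinuousLinearMap.map_smul_of_tower,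
      ← hK, ← hq, Complex.real_smul, Complex.real_smul]
    norm_cast
    have hsq : (2 * s)⁻¹ * q ≤ ε / 2 := by
      rw [inv_mul_le_iff₀ (by positivity)]
      linarith
    linarith

end Damping

section BorelCantelli

variable {H : Type*} [NormedAddCommGroup H] [InnerProductSpace ℂ H] [CompleteSpace H]
  {M : VonNeumannAlgebra H}

theorem apply_le_of_isLUB_range {ι : Type*} [Preorder ι] [IsDirectedOrder ι] [Nonempty ι]
    {ψ : StrongDual ℂ M.Elem} (hψ : ScottContinuous ψ) {f : ι → M.Elem} (hf : Monotone f)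
    {y : M.Elem} (hy : IsLUB (Set.range f) y) {C : ℂ} (hC : ∀ i, ψ (f i) ≤ C) : ψ y ≤ C :=
  (hψ (Set.range_nonempty f) (directedOn_range.2 hf.directed_le) hy).2 <| by
    rintro _ ⟨_, ⟨i, rfl⟩, rfl⟩
    exact hC i

theorem tendsto_ofReal_geometric (C : ℝ) :
    Tendsto (fun n : ℕ => ((C * (1 / 2) ^ n : ℝ) : ℂ)) atTop (𝓝 0) := by
  have h := (tendsto_pow_atTop_nhds_zero_of_lt_one (r := (1 / 2 : ℝ)) (by norm_num)
    (by norm_num)).const_mul C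
  rw [mul_zero] at h
  exact (Complex.continuous_ofReal.tendsto 0).comp h

variable {ψ ω : StrongDual ℂ M.Elem} (hψ : IsPositiveMap ψ) (hψs : ScottContinuous ψ)
  (hω : IsPositiveMap ω) (hωs : ScottContinuous ω)

section Tail

variable {a : ℕ → M.Elem} (ha : ∀ n, 0 ≤ a n)
include ha

theorem monotone_damp_sum_Ico (N : ℕ) :
    Monotone fun m => damp (∑ k ∈ Finset.Ico N m, a k) := fun _ _ h =>
  damp_mono (Finset.sum_nonneg fun k _ => ha k) <|
    Finset.sum_le_sum_of_subset_of_nonneg (Finset.Ico_subset_Ico_right h) fun k _ _ => ha k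

include hψ in
theorem apply_damp_sum_Ico_le (hψa : ∀ n, ψ (a n) ≤ ((1 / 2) ^ n : ℝ)) (N m : ℕ) :
    ψ (damp (∑ k ∈ Finset.Ico N m, a k)) ≤ (2 * (1 / 2) ^ N : ℝ) := by
  have hsum : ∑ k ∈ Finset.Ico N m, (1 / 2 : ℝ) ^ k ≤ 2 * (1 / 2) ^ N := by
    refine (geom_sum_Ico_le_of_lt_one (by norm_num) (by norm_num)).trans_eq ?_
    ring
  calc ψ (damp (∑ k ∈ Finset.Ico N m, a k)) ≤ ψ (∑ k ∈ Finset.Ico N m, a k) :=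
        hψ.monotone (damp_le_self (Finset.sum_nonneg fun k _ => ha k))
    _ ≤ (∑ k ∈ Finset.Ico N m, (1 / 2) ^ k : ℝ) := by
        rw [map_sum, Complex.ofReal_sum]
        exact Finset.sum_le_sum fun k _ => hψa k
    _ ≤ (2 * (1 / 2) ^ N : ℝ) := Complex.real_le_real.2 hsum

include hψ hψs hω in
theorem exists_tail_isLUB (hψa : ∀ n, ψ (a n) ≤ ((1 / 2) ^ n : ℝ))
    (hωa : ∀ n, ω (1 - damp (a n)) ≤ ((1 / 2) ^ n : ℝ)) (N : ℕ) :
    ∃ c, IsLUB (Set.range fun m => damp (∑ k ∈ Finset.Ico N m, a k)) c ∧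
      ψ c ≤ (2 * (1 / 2) ^ N : ℝ) ∧ ω (1 - c) ≤ 0 := by
  have hsum : ∀ m, 0 ≤ ∑ k ∈ Finset.Ico N m, a k := fun m => Finset.sum_nonneg fun k _ => ha k
  have hmono := monotone_damp_sum_Ico ha N
  obtain ⟨c, hc⟩ := exists_isLUB_range_of_monotone hmono fun m => damp_le_one (hsum m)
  refine ⟨c, hc, apply_le_of_isLUB_range hψs hmono hc (apply_damp_sum_Ico_le hψ ha hψa N),
    ge_of_tendsto (tendsto_ofReal_geometric 1) ?_⟩
  filter_upwards [eventually_ge_atTop N] with m hm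
  have hle : damp (a m) ≤ c := (damp_mono (ha m) <| Finset.single_le_sum (fun k _ => ha k)
    (Finset.mem_Ico.2 ⟨hm, m.lt_succ_self⟩)).trans (hc.1 ⟨m + 1, rfl⟩)
  rw [one_mul]
  exact (hω.monotone (sub_le_sub_left hle 1)).trans (hωa m)

end Tail

include hψ hψs hω hωs

/-- A noncommutative Borel–Cantelli argument: the element is `inf_N sup_m damp (∑_{N ≤ k < m} a_k)`
with `ψ (a_k)` and `ω (1 - damp a_k)` at most `2⁻ᵏ`. -/
theorem exists_separating (h : ∀ ε : ℝ, 0 < ε → ∃ a, 0 ≤ a ∧ ψ a ≤ ε ∧ ω (1 - damp a) ≤ ε) :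
    ∃ c, 0 ≤ c ∧ c ≤ 1 ∧ ψ c ≤ 0 ∧ ω (1 - c) ≤ 0 := by
  choose a ha hψa hωa using fun n : ℕ => h ((1 / 2) ^ n) (by positivity)
  have hsum : ∀ N m, 0 ≤ ∑ k ∈ Finset.Ico N m, a k := fun N m => Finset.sum_nonneg fun k _ => ha k
  choose c hc hψc hωc using exists_tail_isLUB hψ hψs hω ha hψa hωa
  have hc0 : ∀ N, 0 ≤ c N := fun N => (damp_nonneg (hsum N N)).trans ((hc N).1 ⟨N, rfl⟩)
  have hc1 : ∀ N, c N ≤ 1 := fun N => (hc N).2 <| by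
    rintro _ ⟨m, rfl⟩
    exact damp_le_one (hsum N m)
  have hanti : Antitone c := fun N N' hN => (hc N').2 <| by
    rintro _ ⟨m, rfl⟩
    exact (damp_mono (hsum N' m) <| Finset.sum_le_sum_of_subset_of_nonneg
      (Finset.Ico_subset_Ico_left hN) fun k _ _ => ha k).trans ((hc N).1 ⟨m, rfl⟩)
  have hmono : Monotone fun N => 1 - c N := fun N N' hN => sub_le_sub_left (hanti hN) 1
  obtain ⟨e, he⟩ := exists_isLUB_range_of_monotone hmono fun N => sub_le_self 1 (hc0 N)
  have hle : ∀ N, 1 - e ≤ c N := fun N => sub_le_comm.1 (he.1 ⟨N, rfl⟩)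
  refine ⟨1 - e, sub_nonneg.2 (he.2 ?_), sub_le_self 1 ((sub_nonneg.2 (hc1 0)).trans
    (he.1 ⟨0, rfl⟩)), ?_, ?_⟩
  · rintro _ ⟨N, rfl⟩
    exact sub_le_self 1 (hc0 N)
  · exact ge_of_tendsto' (tendsto_ofReal_geometric 2) fun N => (hψ.monotone (hle N)).trans (hψc N)
  · rw [sub_sub_cancel]
    exact apply_le_of_isLUB_range hωs hmono he hωc

end BorelCantelli

section SingularNormal

variable {H : Type*} [NormedAddCommGroup H] [InnerProductSpace ℂ H] [CompleteSpace H]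
  {M : VonNeumannAlgebra H}

theorem exists_apply_one_sub_damp_le {ψ ω : StrongDual ℂ M.Elem} (hψ : IsPositiveMap ψ)
    (hω : IsPositiveMap ω) {c : M.Elem} (hc0 : 0 ≤ c) (hc1 : c ≤ 1) (hψc : ψ c ≤ 0)
    (hωc : ω (1 - c) ≤ 0) {s : ℝ} (hs : 0 < s) :
    ∃ a, 0 ≤ a ∧ ψ a ≤ 0 ∧ ω (1 - damp a) ≤ s • ω 1 := by
  have hc : star c = c := IsSelfAdjoint.of_nonneg hc0
  have hcc : c * c ≤ c := mul_self_le_self hc0 hc1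
  have hcc' : (1 - c) * (1 - c) ≤ 1 - c :=
    mul_self_le_self (sub_nonneg.2 hc1) (sub_le_self 1 hc0)
  set t := s / (3 / 2)
  have ht : 0 < t := by positivity
  have key := hω.monotone (one_sub_damp_le ht c)
  rw [star_sub, star_one, hc, map_add, ContinuousLinearMap.map_smul_of_tower,
    ContinuousLinearMap.map_smul_of_tower] at key
  refine ⟨(t ^ 2)⁻¹ • (c * c), smul_nonneg (by positivity) ?_, ?_, ?_⟩
  · exact (IsSelfAdjoint.of_nonneg hc0).mul_self_nonneg
  · rw [ContinuousLinearMap.map_smul_of_tower]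
    exact smul_nonpos_of_nonneg_of_nonpos (by positivity) ((hψ.monotone hcc).trans hψc)
  · have hst : 3 / 2 * t = s := mul_div_cancel₀ s (by norm_num)
    rw [← hst]
    exact key.trans <| add_le_of_nonpos_right <|
      smul_nonpos_of_nonneg_of_nonpos (by positivity) ((hω.monotone hcc').trans hωc)

theorem apply_one_nonpos_of_separated {ψ : StrongDual ℂ M.Elem} (hψ : IsPositiveMap ψ)
    (hψs : ScottContinuous ψ) (h : ∀ ξ : H, ∃ c : M.Elem, 0 ≤ c ∧ c ≤ 1 ∧ ψ c ≤ 0 ∧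
      vectorFunctional ξ ξ (1 - c) ≤ 0) : ψ 1 ≤ 0 := by
  let ι := {a : M.Elem // 0 ≤ a ∧ ψ a ≤ 0}
  have : Nonempty ι := ⟨0, le_rfl, (map_zero ψ).le⟩
  have : IsDirectedOrder ι := ⟨fun a b => ⟨⟨a + b, add_nonneg a.2.1 b.2.1, by
    rw [map_add]
    exact add_nonpos a.2.2 b.2.2⟩, le_add_of_nonneg_right b.2.1, le_add_of_nonneg_left a.2.1⟩⟩
  have hmono : Monotone fun a : ι => damp (a : M.Elem) := fun a _ hab => damp_mono a.2.1 hab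
  obtain ⟨p, hp⟩ := exists_isLUB_range_of_monotone hmono fun a => damp_le_one a.2.1
  have hψp : ψ p ≤ 0 := apply_le_of_isLUB_range hψs hmono hp fun a =>
    (hψ.monotone (damp_le_self a.2.1)).trans a.2.2
  have hp1 : 1 ≤ p := sub_nonpos.1 <| le_iff.2 fun ξ => by
    have hω := vectorFunctional_self_isPositiveMap (M := M) ξ
    obtain ⟨c, hc0, hc1, hψc, hωc⟩ := h ξ
    have hlim : Tendsto (fun n : ℕ => (1 / 2 : ℝ) ^ n • vectorFunctional ξ ξ (1 : M.Elem)) atTop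
        (𝓝 0) := by
      simpa only [zero_smul] using (tendsto_pow_atTop_nhds_zero_of_lt_one (r := (1 / 2 : ℝ))
        (by norm_num) (by norm_num)).smul_const (vectorFunctional ξ ξ (1 : M.Elem))
    refine (ge_of_tendsto' hlim fun n => ?_).trans_eq (map_zero (vectorFunctional ξ ξ)).symm
    obtain ⟨a, ha0, hψa, hωa⟩ := exists_apply_one_sub_damp_le hψ hω hc0 hc1 hψc hωc
      (s := (1 / 2) ^ n) (by positivity)
    exact (hω.monotone (sub_le_sub_left (hp.1 ⟨⟨a, ha0, hψa⟩, rfl⟩) 1)).trans hωa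
  exact (hψ.monotone hp1).trans hψp

theorem scottContinuous_cutoff_one_sub {τ : M.Elem →L[ℂ] M.Elem} (hτ : IsCP τ)
    (hτs : ScottContinuous τ) {z₀ : Bidual M.Elem} (hz₀ : IsNormalProjection z₀) :
    ScottContinuous (cutoff τ (1 - z₀)) :=
  scottContinuous_of_vectorFunctional fun ξ => by
    have hω := scottContinuous_vectorFunctional (M := M) ξ
    have hsub : (fun a => vectorFunctional ξ ξ (cutoff τ (1 - z₀) a)) =
        vectorFunctional ξ ξ ∘ τ - vectorFunctional ξ ξ ∘ cutoff τ z₀ := by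
      ext a
      rw [Pi.sub_apply, Function.comp_apply, Function.comp_apply, ← map_sub, eq_comm]
      congr 1
      rw [sub_eq_iff_eq_add', ← add_apply, cutoff_add_cutoff_one_sub]
    have hpos : IsPositiveMap (cutoff τ (1 - z₀)) :=
      isPositiveMap_of_isCP (isCP_cutoff hτ (isCentralProjection_of_isNormalProjection hz₀).one_sub)
    rw [hsub]
    refine scottContinuous_complex_sub (hτs.comp hω) ((scottContinuous_cutoff hτ hz₀).comp hω) ?_
    rw [← hsub]
    exact (hpos.vectorFunctional_comp ξ).monotone

theorem cutoff_one_sub_apply_one_of_scottContinuous {τ : M.Elem →L[ℂ] M.Elem} (hτ : IsCP τ)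
    (hτs : ScottContinuous τ) {z₀ : Bidual M.Elem} (hz₀ : IsNormalProjection z₀) :
    cutoff τ (1 - z₀) 1 = 0 := by
  have hz := isCentralProjection_of_isNormalProjection hz₀
  have hσ : IsPositiveMap (cutoff τ (1 - z₀)) := isPositiveMap_of_isCP (isCP_cutoff hτ hz.one_sub)
  refine le_antisymm (le_iff.2 fun ξ => ?_) (hσ 1 zero_le_one)
  set ω : StrongDual ℂ M.Elem := vectorFunctional ξ ξ
  set ψ := ω ∘L cutoff τ (1 - z₀) with hψ_def
  have hψ : IsPositiveMap ψ := hσ.vectorFunctional_comp ξ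
  have hψs : ScottContinuous ψ :=
    (scottContinuous_cutoff_one_sub hτ hτs hz₀).comp (scottContinuous_vectorFunctional ξ)
  have hzψ : z₀.act ψ = 0 := by
    rw [hψ_def, comp_cutoff _ _ (vectorFunctional_mem_predual ξ ξ), hz.one_sub_act_act]
  refine (apply_one_nonpos_of_separated hψ hψs fun η => ?_).trans_eq (map_zero ω).symm
  have hη := vectorFunctional_mem_predual (M := M) η η
  exact exists_separating hψ hψs (vectorFunctional_self_isPositiveMap η)
    (scottContinuous_vectorFunctional η) fun ε hε => hz.exists_damp_approx hψ
      (vectorFunctional_self_isPositiveMap η) hzψ (act_eq_self_of_mem_predual hz₀ hη) hε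

end SingularNormal

section Decomposition

theorem IsPositiveMap.eq_zero_of_map_one {A F : Type*} [CStarAlgebra A] [PartialOrder A]
    [StarOrderedRing A] [NormedAddCommGroup F] [NormedSpace ℂ F] [PartialOrder F]
    [IsOrderedAddMonoid F] {κ : A →L[ℂ] F} (hκ : IsPositiveMap κ) (h1 : κ 1 = 0) : κ = 0 := by
  refine ContinuousLinearMap.coe_inj.1 (LinearMap.ext_on CStarAlgebra.span_nonneg fun a ha => ?_)
  refine le_antisymm ?_ (hκ a ha)
  calc κ a ≤ κ (algebraMap ℝ A ‖a‖) :=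
        hκ.monotone (IsSelfAdjoint.of_nonneg ha).le_algebraMap_norm_self
    _ = 0 := by
      rw [Algebra.algebraMap_eq_smul_one, ContinuousLinearMap.map_smul_of_tower, h1, smul_zero]

theorem smul_one_eq_or_of_mem_Icc {A : Type*} [CStarAlgebra A] [PartialOrder A]
    [StarOrderedRing A] {c : ℂ} (h : c • (1 : A) ∈ Set.Icc 0 1) :
    c • (1 : A) = 0 ∨ c • (1 : A) = 1 ∨
      ∃ l : ℝ, 0 < l ∧ l < 1 ∧ c • (1 : A) = (l : ℂ) • (1 : A) := by
  have hre : c • (1 : A) = c.re • (1 : A) := by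
    rw [← (IsSelfAdjoint.of_nonneg h.1).coe_realPart, realPart_smul]
    simp
  rw [hre] at h ⊢
  rcases le_or_gt c.re 0 with hc | h0
  · exact .inl (le_antisymm (smul_nonpos_of_nonpos_of_nonneg hc zero_le_one) h.1)
  rcases lt_or_ge c.re 1 with h1 | hc
  · exact .inr <| .inr ⟨c.re, h0, h1, (Complex.coe_smul _ _).symm⟩
  · refine .inr <| .inl <| le_antisymm h.2 ?_
    simpa only [one_smul] using smul_le_smul_of_nonneg_right hc (zero_le_one (α := A))

variable {H : Type*} [NormedAddCommGroup H] [InnerProductSpace ℂ H] [CompleteSpace H]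
  {M : VonNeumannAlgebra H} {z₀ : Bidual M.Elem} {τ : M.Elem →L[ℂ] M.Elem}

theorem cutoff_eq_zero_iff (hτ : IsCP τ) {z : Bidual M.Elem} (hz : IsCentralProjection z) :
    cutoff τ z = 0 ↔ normalExt τ z = 0 := by
  rw [← cutoff_apply_one]
  exact ⟨fun h => by rw [h]; rfl, (isPositiveMap_of_isCP (isCP_cutoff hτ hz)).eq_zero_of_map_one⟩

theorem mem_CPs_iff (hz₀ : IsNormalProjection z₀) (hτ : τ ∈ CP M) :
    τ ∈ CPs z₀ ↔ normalExt τ z₀ = 0 := by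
  have hz := isCentralProjection_of_isNormalProjection hz₀
  have hpair : ∀ ω ∈ M.predual, ∀ x, (z₀ * Bidual.incl x) (ω ∘L τ) = ω (cutoff τ z₀ x) :=
    fun ω hω x => by rw [(hz.commute _).eq, apply_comp_eq_normalExt τ hω, cutoff_apply]
  rw [← cutoff_eq_zero_iff hτ.1 hz]
  refine ⟨fun h => ContinuousLinearMap.ext fun x => eq_of_forall_inner fun ξ η => ?_, fun h =>
    ⟨hτ, fun ω hω x => ?_⟩⟩
  · have hω := vectorFunctional_mem_predual (M := M) ξ η
    exact ((hpair _ hω x).symm.trans (h.2 _ hω x)).trans (inner_zero_right ξ).symm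
  · rw [hpair ω hω x, h]
    exact map_zero ω

theorem normalExt_one_sub (hτ : τ ∈ CP M) (z : Bidual M.Elem) :
    normalExt τ (1 - z) = 1 - normalExt τ z := by
  rw [map_sub]
  congr 1
  exact (normalExt_incl τ 1).trans hτ.2

theorem mem_CPσ_iff (hz₀ : IsNormalProjection z₀) (hτ : τ ∈ CP M) :
    τ ∈ CPσ M ↔ normalExt τ z₀ = 1 := by
  have hz := isCentralProjection_of_isNormalProjection hz₀
  rw [eq_comm, ← sub_eq_zero, ← normalExt_one_sub hτ]
  refine ⟨fun h => ?_, fun h => ⟨hτ, ?_⟩⟩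
  · rw [← cutoff_apply_one, cutoff_one_sub_apply_one_of_scottContinuous hτ.1 h.2 hz₀]
  · rw [← cutoff_add_cutoff_one_sub τ z₀, (cutoff_eq_zero_iff hτ.1 hz.one_sub).2 h, add_zero]
    exact scottContinuous_cutoff hτ.1 hz₀

theorem inv_smul_cutoff_mem_CP (hτ : τ ∈ CP M) {z : Bidual M.Elem} (hz : IsCentralProjection z)
    {r : ℝ} (hr : 0 < r) (h : normalExt τ z = (r : ℂ) • (1 : M.Elem)) :
    ((r⁻¹ : ℝ) : ℂ) • cutoff τ z ∈ CP M := by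
  refine ⟨isCP_smul (isCP_cutoff hτ.1 hz) (inv_nonneg.2 hr.le), ?_⟩
  rw [smul_apply, cutoff_apply_one, h, Complex.ofReal_inv,
    inv_smul_smul₀ (Complex.ofReal_ne_zero.2 hr.ne')]

theorem exists_convex_combination_iff (hz₀ : IsNormalProjection z₀) (hτ : τ ∈ CP M) {l : ℝ}
    (hl0 : 0 < l) (hl1 : l < 1) :
    (∃ τσ ∈ CPσ M, ∃ τs ∈ CPs z₀, τ = (l : ℂ) • τσ + (1 - l : ℂ) • τs) ↔
      normalExt τ z₀ = (l : ℂ) • (1 : M.Elem) := by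
  have hz := isCentralProjection_of_isNormalProjection hz₀
  constructor
  · rintro ⟨τσ, hσ, τs, hs, rfl⟩
    rw [normalExt_add, normalExt_smul, normalExt_smul, add_apply,
      smul_apply, smul_apply,
      (mem_CPσ_iff hz₀ hσ.1).1 hσ, (mem_CPs_iff hz₀ hs.1).1 hs, smul_zero, add_zero]
  · intro h
    have h' : normalExt τ (1 - z₀) = ((1 - l : ℝ) : ℂ) • (1 : M.Elem) := by
      rw [normalExt_one_sub hτ, h, Complex.ofReal_sub, sub_smul, Complex.ofReal_one, one_smul]
    have hσ := inv_smul_cutoff_mem_CP hτ hz hl0 h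
    have hs := inv_smul_cutoff_mem_CP hτ hz.one_sub (sub_pos.2 hl1) h'
    refine ⟨_, (mem_CPσ_iff hz₀ hσ).2 ?_, _, (mem_CPs_iff hz₀ hs).2 ?_, ?_⟩
    · rw [normalExt_smul, smul_apply, normalExt_cutoff,
        hz.isIdempotentElem.eq, ← cutoff_apply_one]
      exact hσ.2
    · rw [normalExt_smul, smul_apply, normalExt_cutoff, mul_sub, mul_one,
        hz.isIdempotentElem.eq, sub_self, map_zero, smul_zero]
    · rw [← Complex.ofReal_one, ← Complex.ofReal_sub, Complex.ofReal_inv, Complex.ofReal_inv,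
        smul_inv_smul₀ (Complex.ofReal_ne_zero.2 hl0.ne'),
        smul_inv_smul₀ (Complex.ofReal_ne_zero.2 (sub_pos.2 hl1).ne'), cutoff_add_cutoff_one_sub]

theorem normalExt_mem_Icc (hz₀ : IsNormalProjection z₀) (hτ : τ ∈ CP M) :
    normalExt τ z₀ ∈ Set.Icc 0 1 := by
  have nonneg_of_isCentralProjection : ∀ z, IsCentralProjection z → 0 ≤ normalExt τ z :=
    fun z hz => cutoff_apply_one τ z ▸ isPositiveMap_of_isCP (isCP_cutoff hτ.1 hz) 1 zero_le_one
  have hz := isCentralProjection_of_isNormalProjection hz₀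
  refine ⟨nonneg_of_isCentralProjection z₀ hz, sub_nonneg.1 ?_⟩
  rw [← normalExt_one_sub hτ]
  exact nonneg_of_isCentralProjection _ hz.one_sub

theorem exists_normalExt_eq_smul_iff (hz₀ : IsNormalProjection z₀) (hτ : τ ∈ CP M) :
    (∃ c : ℂ, normalExt τ z₀ = c • (1 : M.Elem)) ↔ τ ∈ CPσ M ∨ τ ∈ CPs z₀ ∨
      ∃ l : ℝ, 0 < l ∧ l < 1 ∧ normalExt τ z₀ = (l : ℂ) • (1 : M.Elem) := by
  rw [mem_CPσ_iff hz₀ hτ, mem_CPs_iff hz₀ hτ]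
  constructor
  · rintro ⟨c, hc⟩
    rw [hc]
    exact or_left_comm.1 (smul_one_eq_or_of_mem_Icc (hc ▸ normalExt_mem_Icc hz₀ hτ))
  · rintro (h | h | ⟨l, -, -, h⟩)
    · exact ⟨1, h.trans (one_smul ℂ 1).symm⟩
    · exact ⟨0, h.trans (zero_smul ℂ 1).symm⟩
    · exact ⟨l, h⟩

end Decomposition

end EnvelopingAlgebra

end

open VonNeumannAlgebra in
theorem proposition2p6 {H : Type*} [NormedAddCommGroup H] [InnerProductSpace ℂ H]
    [CompleteSpace H] (M : VonNeumannAlgebra H) (z₀ : Bidual M.Elem)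
    (hz₀ : IsNormalProjection z₀) :
    -- `τ̃` is the unique unital normal completely positive map with the duality relation
    (∀ τ ∈ CP M, IsNormalExt τ (normalExt τ) ∧ ∀ T, IsNormalExt τ T → T = normalExt τ) ∧
    -- proper convex combinations with a given weight
    (∀ τ ∈ CP M, ∀ l : ℝ, 0 < l → l < 1 →
      ((∃ τσ ∈ CPσ M, ∃ τs ∈ CPs z₀, τ = (l : ℂ) • τσ + (1 - l : ℂ) • τs) ↔
        normalExt τ z₀ = (l : ℂ) • (1 : M.Elem))) ∧
    -- all the cases in which `τ̃(z₀)` is a scalar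
    (∀ τ ∈ CP M,
      ((∃ c : ℂ, normalExt τ z₀ = c • (1 : M.Elem)) ↔
        (τ ∈ CPσ M ∨ τ ∈ CPs z₀ ∨ ∃ l : ℝ, 0 < l ∧ l < 1 ∧
          ∃ τσ ∈ CPσ M, ∃ τs ∈ CPs z₀, τ = (l : ℂ) • τσ + (1 - l : ℂ) • τs))) ∧
    -- the map `τ ↦ τ̃` on `CP` is affine and one-to-one
    (∀ τ₁ ∈ CP M, ∀ τ₂ ∈ CP M, ∀ t : ℝ, 0 ≤ t → t ≤ 1 →
      normalExt ((t : ℂ) • τ₁ + (1 - t : ℂ) • τ₂) =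
        (t : ℂ) • normalExt τ₁ + (1 - t : ℂ) • normalExt τ₂) ∧
    Set.InjOn normalExt (CP M) := by
  refine ⟨fun τ hτ => ⟨EnvelopingAlgebra.isNormalExt_normalExt hτ, fun T =>
      EnvelopingAlgebra.eq_normalExt_of_isNormalExt⟩,
    fun τ hτ l hl0 hl1 => EnvelopingAlgebra.exists_convex_combination_iff hz₀ hτ hl0 hl1,
    fun τ hτ => ?_, fun τ₁ _ τ₂ _ t _ _ => ?_, EnvelopingAlgebra.normalExt_injective.injOn⟩
  · rw [EnvelopingAlgebra.exists_normalExt_eq_smul_iff hz₀ hτ]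
    refine or_congr_right (or_congr_right (exists_congr fun l => and_congr_right fun hl0 =>
      and_congr_right fun hl1 => ?_))
    exact (EnvelopingAlgebra.exists_convex_combination_iff hz₀ hτ hl0 hl1).symm
  · rw [EnvelopingAlgebra.normalExt_add, EnvelopingAlgebra.normalExt_smul,
      EnvelopingAlgebra.normalExt_smul]
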